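/- **Conventions.** For functions of $m$, $g=\tilde O(f)$ means $g=O(f\log^{C}f)$ and $h=\tilde\Omega(f)$ means $h=\Omega(f/\log^{C}f)$ for some constant $C$. A CNF formula is hitting if any two distinct clauses of it contain contrary literals. Resolution (dag-like) and tree-like Resolution derive from $C\ni x$ and $D\ni\bar x$ the clause $(C\setminus\{x\})\cup(D\setminus\{\bar x\})$; the size of a refutation is its number of clauses (of clause occurrences, if tree-like), and its width is the maximal number of literals in a clause of it. For a set $S$ of variables, $x|_S$ is a certificate for $f$ if $f(y)=f(x)$ for all $y$ that agree with $x$ on $S$. $\mathsf C(f)$ is the maximum over $x$ of the minimal size of a certificate $x|_S$. $f\circ g$ is the composition of $f$ with independent copies of $g$, one for each variable of $f$. **Cheat sheets.** Let $f$ be a Boolean function of $N$ variables, $L=\lceil\log_2N\rceil$ and $c=10L$. The function $f_{\mathrm{CS}}$ has as its input $x^1,\dots,x^c\in\{0,1\}^N$ and cells $Y_\ell\in\{0,1\}^{c\cdot\mathsf C(f)\cdot L}$ for $\ell\in\{0,1\}^c$. A cell is read as $\mathsf C(f)$ pointers of $L$ bits for each $i\in[c]$; each pointer is the number, in binary, of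 a variable of $x^i$ (numbers out of range are ignored). With $\ell=(f(x^1),\dots,f(x^c))$, the value of $f_{\mathrm{CS}}$ is $1$ if and only if for each $i$ the positions in $x^i$ to which $Y_\ell$ points form a certificate for $f(x^i)=\ell_i$. **The functions and their certificates.** Let $f_0=\mathrm{AND}_n$ and $f_{k+1}=\mathrm{AND}_n\circ(\mathrm{OR}_n\circ f_k)_{\mathrm{CS}}$. For each input $x$ the following set $S(x)$ of variables gives an unambiguous certificate $x|_{S(x)}$. For $\mathrm{AND}_n$ (for $\mathrm{OR}_n$): all variables up to and including the first $0$ (the first $1$), or all variables if there is none. For $\oplus_2$: both variables. For $f\circ g$: the variables $(i,j)$ such that $i$ is in the set of $f$ for the values of the copies of $g$, and $j$ is in the set of $g$ for the input of the $i$-th copy. For $f_{\mathrm{CS}}$: the cell $Y_\ell$ and the positions it points to and, if the value is $0$, also the sets of $f$ for $x^1,\dots,x^c$. **The formulas.** Fix $k\ge0$. For $m\ge0$ let $n=\lfloor m^{1/(k+1)}\rfloor$, and let $F_b$, for $b\in\{0,1\}$, be the DNF whose terms are the certificates $x|_{S(x)}$ of the inputs $x$ of value $b$ of $f_k\circ\oplus_2$.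 Let $G_m=\overline{F_0\lor F_1}$, a CNF formula. **Theorem.** Let $\varepsilon>0$ and let $k\ge0$ be an integer with $1/(k+1)\le\varepsilon$. The formulas $G_m$ are unsatisfiable hitting formulas with $2^{\tilde O(m)}$ clauses of width at most $\tilde O(m)$, every tree-like Resolution refutation of $G_m$ has size at least $2^{\tilde\Omega(m^{2-\varepsilon})}$, and $G_m$ has a dag-like Resolution refutation that has width $\tilde O(m)$ and size $2^{\tilde O(m)}$. The constants hidden in $\tilde O$ and $\tilde\Omega$ depend only on $\varepsilon$ and $k$. -/

import Mathlib

noncomputable section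

namespace HittingRes

open scoped Classical

/-! ### Soft asymptotics, constants independent of the argument -/

/-- `g = Õ(f)`: `g ≤ a · f · log^C f` eventually, for constants `a`, `C`. -/
def SoftO (g f : ℕ → ℝ) : Prop :=
  ∃ (a : ℝ) (C : ℕ), ∀ᶠ m in Filter.atTop, g m ≤ a * (f m * Real.log (f m) ^ C)

/-- `h = Ω̃(f)`: `h ≥ a · f / log^C f` eventually, for constants `a > 0`, `C`. -/
def SoftOmega (h f : ℕ → ℝ) : Prop :=
  ∃ (a : ℝ) (C : ℕ), 0 < a ∧ ∀ᶠ m in Filter.atTop, a * (f m / Real.log (f m) ^ C) ≤ h m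

/-! ### Clauses, hitting formulas and Resolution -/

/-- The literal `(v, b)` is true under `x` exactly when `x v = b`. -/
abbrev Literal (V : Type) := V × Bool

/-- A clause is the disjunction of a finite set of literals. -/
abbrev Clause (V : Type) := Finset (Literal V)

/-- A CNF formula is the conjunction of a finite set of clauses. -/
abbrev CNF (V : Type) := Finset (Clause V)

/-- The clause `C` is false under the assignment `x`. -/
def Falsifies {V : Type} (x : V → Bool) (C : Clause V) : Prop :=
  ∀ l ∈ C, x l.1 ≠ l.2

/-- No assignment satisfies all clauses of `F`. -/
def Unsat {V : Type} (F : CNF V) : Prop :=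
  ∀ x : V → Bool, ∃ C ∈ F, Falsifies x C

/-- Any two distinct clauses of `F` contain contrary literals. -/
def IsHitting {V : Type} (F : CNF V) : Prop :=
  ∀ C ∈ F, ∀ D ∈ F, C ≠ D → ∃ (v : V) (b : Bool), (v, b) ∈ C ∧ (v, !b) ∈ D

/-- `R` follows from `C` and `D` by the resolution rule. -/
def IsResolvent {V : Type} [DecidableEq V] (C D R : Clause V) : Prop :=
  ∃ v : V, (v, true) ∈ C ∧ (v, false) ∈ D ∧
    R = C.erase (v, true) ∪ D.erase (v, false)

/-- `π` is a dag-like Resolution derivation from `F`, listed with the newest clause first: each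
clause is a clause of `F` or the resolvent of two clauses derived before it. -/
inductive ResDerivation {V : Type} [DecidableEq V] (F : CNF V) : List (Clause V) → Prop
  | nil : ResDerivation F []
  | initial {π : List (Clause V)} {C : Clause V} :
      ResDerivation F π → C ∈ F → ResDerivation F (C :: π)
  | resolve {π : List (Clause V)} {C D R : Clause V} :
      ResDerivation F π → C ∈ π → D ∈ π → IsResolvent C D R → ResDerivation F (R :: π)

/-- A Resolution refutation of `F`: a derivation from `F` that contains the empty clause. Its size
is its length and its width is the largest number of literals in one of its clauses. -/
def ResRefutation {V : Type} [DecidableEq V] (F : CNF V) (π : List (Clause V)) : Prop :=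
  ResDerivation F π ∧ ∅ ∈ π

/-- `TreeResDerivation F C s`: the clause `C` has a tree-like Resolution derivation from `F`
that consists of exactly `s` clause occurrences. -/
inductive TreeResDerivation {V : Type} [DecidableEq V] (F : CNF V) : Clause V → ℕ → Prop
  | initial {C : Clause V} : C ∈ F → TreeResDerivation F C 1
  | resolve {C D R : Clause V} {s t : ℕ} :
      TreeResDerivation F C s → TreeResDerivation F D t → IsResolvent C D R →
        TreeResDerivation F R (s + t + 1)

/-! ### Boolean functions and certificates -/

/-- The inputs `x` and `y` agree on the set `S` of variables. -/
def AgreeOn {V : Type} (S : Finset V) (x y : V → Bool) : Prop :=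
  ∀ v ∈ S, x v = y v

/-- The restriction of the input `x` to `S` is a certificate for `f`. -/
def IsCertificate {V : Type} (f : (V → Bool) → Bool) (x : V → Bool) (S : Finset V) : Prop :=
  ∀ y : V → Bool, AgreeOn S x y → f y = f x

/-- The certificate complexity `C(f) = max_x C(f, x)`. -/
def certComplexity {V : Type} [Fintype V] [DecidableEq V] (f : (V → Bool) → Bool) : ℕ :=
  Finset.univ.sup fun x : V → Bool =>
    sInf {s : ℕ | ∃ S : Finset V, S.card = s ∧ IsCertificate f x S}

/-- A Boolean function `eval` on finitely many variables, together with the choice, for each input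
`x`, of a set `cert x` of variables. The restrictions of the inputs `x` to the sets `cert x` are the
designated certificates of the function. -/
structure BoolFun where
  Var : Type
  [fintypeVar : Fintype Var]
  [decEqVar : DecidableEq Var]
  eval : (Var → Bool) → Bool
  cert : (Var → Bool) → Finset Var

attribute [instance] BoolFun.fintypeVar BoolFun.decEqVar

/-- `AND_n`; the variables are inspected in order, up to and including the first `0`. -/
abbrev andFun (n : ℕ) : BoolFun where
  Var := Fin n
  eval x := decide (∀ i, x i = true)
  cert x := Finset.univ.filter fun j => ∀ i < j, x i = true

/-- `OR_n`; the variables are inspected in order, up to and including the first `1`. -/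
abbrev orFun (n : ℕ) : BoolFun where
  Var := Fin n
  eval x := decide (∃ i, x i = true)
  cert x := Finset.univ.filter fun j => ∀ i < j, x i = false

/-- The parity of two bits; both are inspected. -/
abbrev xorFun : BoolFun where
  Var := Fin 2
  eval x := xor (x 0) (x 1)
  cert _ := Finset.univ

/-- The composition `f ∘ gⁿ`, whose certificates are composed of those of `f` and of `g`: in a
certificate of `f`, each inspected variable is replaced by a certificate of its copy of `g`. -/
abbrev comp (f g : BoolFun) : BoolFun where
  Var := f.Var × g.Var
  eval x := f.eval fun i => g.eval fun j => x (i, j)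
  cert x := Finset.univ.filter fun p =>
    p.1 ∈ f.cert (fun i => g.eval fun j => x (i, j)) ∧ p.2 ∈ g.cert (fun j => x (p.1, j))

/-! ### Cheat sheets -/

/-- `⌈log₂ N⌉`, the number of bits of a pointer to one of the `N` variables of `f`. -/
def pointerBits (f : BoolFun) : ℕ := Nat.clog 2 (Fintype.card f.Var)

/-- `c = 10 ⌈log₂ N⌉`, the number of copies of `f`. -/
def copies (f : BoolFun) : ℕ := 10 * pointerBits f

/-- The variable of `f` whose number (in a fixed enumeration) is written in binary in `b`, if the
number is in range. -/
def decodePointer (f : BoolFun) (b : Fin (pointerBits f) → Bool) : Option f.Var :=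
  if h : Nat.ofBits b < Fintype.card f.Var then
    some ((Fintype.equivFin f.Var).symm ⟨Nat.ofBits b, h⟩)
  else none

/-- The set of variables of `f` that are described by a list of `C(f)` pointers. -/
def pointedSet (f : BoolFun)
    (Y : Fin (certComplexity f.eval) → Fin (pointerBits f) → Bool) : Finset f.Var :=
  Finset.univ.filter fun v => ∃ s, decodePointer f (Y s) = some v

/-- The variables of the cheat sheet version of `f`: `c` inputs of `f`, and for each
`ℓ ∈ {0,1}^c` a cell `Y_ℓ` of `c · C(f) · ⌈log₂ N⌉` bits. -/
abbrev CheatVar (f : BoolFun) : Type :=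
  (Fin (copies f) × f.Var) ⊕
    ((Fin (copies f) → Bool) × Fin (copies f) × Fin (certComplexity f.eval) × Fin (pointerBits f))

/-- The input `x^i` of the `i`-th copy of `f`. -/
def copyInput {f : BoolFun} (x : CheatVar f → Bool) (i : Fin (copies f)) : f.Var → Bool :=
  fun v => x (Sum.inl (i, v))

/-- The address `ℓ = (f(x^1), …, f(x^c))`. -/
def address {f : BoolFun} (x : CheatVar f → Bool) : Fin (copies f) → Bool :=
  fun i => f.eval (copyInput x i)

/-- The variables of the `i`-th copy of `f` that the cell `Y_ℓ` at the address `ℓ` points to. -/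
def cellPositions {f : BoolFun} (x : CheatVar f → Bool) (i : Fin (copies f)) : Finset f.Var :=
  pointedSet f fun s j => x (Sum.inr (address x, i, s, j))

/-- The value of the cheat sheet version of `f`: it is `1` if and only if, for each `i`, the variables
that `Y_ℓ` points to in `x^i` form a certificate for `f(x^i) = ℓ_i`. -/
def cheatEval (f : BoolFun) (x : CheatVar f → Bool) : Bool :=
  decide (∀ i, IsCertificate f.eval (copyInput x i) (cellPositions x i))

/-- The cheat sheet version `f_CS`. The certificate of `x` consists of the contents of `Y_ℓ` and the
positions described there and, for a `0`-input, of the designated certificates of all `x^i` too. -/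
abbrev cheatSheet (f : BoolFun) : BoolFun where
  Var := CheatVar f
  eval := cheatEval f
  cert x := Finset.univ.filter fun p =>
    match p with
    | Sum.inl (i, v) =>
        v ∈ cellPositions x i ∨ (cheatEval f x = false ∧ v ∈ f.cert (copyInput x i))
    | Sum.inr (l, _) => l = address x

/-- `f_0 = AND_n` and `f_{k+1} = AND_n ∘ (OR_n ∘ f_k)_CS`. -/
def akkFun (n : ℕ) : ℕ → BoolFun
  | 0 => andFun n
  | k + 1 => comp (andFun n) (cheatSheet (comp (orFun n) (akkFun n k)))

/-! ### The formulas -/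

/-- The terms (as sets of literals) of the unambiguous DNF `F_b` for `f = b` that consists of the
designated certificates of the inputs `x` with `f x = b`. -/
def dnfTerms (f : BoolFun) (b : Bool) : Finset (Finset (Literal f.Var)) :=
  (Finset.univ.filter fun x : f.Var → Bool => f.eval x = b).image fun x =>
    (f.cert x).image fun v => (v, x v)

/-- The negation of a term: the clause of the opposite literals. -/
def negTerm {V : Type} [DecidableEq V] (T : Finset (Literal V)) : Clause V :=
  T.image fun l => (l.1, !l.2)

/-- The CNF `¬(F_0 ∨ F_1)`. -/
def partitionCNF (f : BoolFun) : CNF f.Var :=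
  (dnfTerms f false ∪ dnfTerms f true).image negTerm

/-- `f_k ∘ ⊕_2` for `n = ⌊m^{1/(k+1)}⌋`. -/
def xorAkk (k m : ℕ) : BoolFun := comp (akkFun (Nat.nthRoot (k + 1) m) k) xorFun

/-- The formula `G_m`, for the parameter `k`. -/
def hittingFormula (k m : ℕ) : CNF (xorAkk k m).Var := partitionCNF (xorAkk k m)

end HittingRes

end

namespace HittingRes

/-! Put n ≈ m^{1/(k+1)}. The function f_k has unambiguous certificates of size Õ(n^{k+1}) = Õ(m),
but deterministic query complexity Ω(n^{2k+1}) = Ω(m^{2-1/(k+1)}). The theorem expresses this gap in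
terms of Resolution.

Hitting: two certificates without a conflict have a common extension, and by unambiguity they both
equal its certificate (`Unambiguous.isHitting`). Unsatisfiability: each input falsifies the clause
of its own certificate.

Tree-like lower bound: a small tree-like refutation for f ∘ ⊕_2 yields a shallow decision tree for
f, since a query to f is paid for by an earlier halving of the refutation (`decides_fill_parities`).
By adversary arguments, AND_n and OR_n each multiply the query complexity by n
(`sum_queryDepth_le_of_decides_and`), and a cheat sheet lowers it by at most 1
(`depth_le_cheatSheet`).

Small certificates: let h = OR_n ∘ f_k. A 1-certificate of h_CS is one cell with the positions it
points to, so it costs Õ(C(h)), not the n times larger unambiguous certificates of h. Here C(h) =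
Õ(n^{k+1}), because 0-inputs of f_k have ambiguous certificates of size Õ(n^k). The outer AND_n
inspects many copies of value 1 but at most one, expensive, copy of value 0
(`card_comp_andFun_cert_le`, `akkFun_bounds`).

Dag-like upper bound: a certificate can be found by queries with only Õ(m) bits in memory
(`WithMemory`). Read backwards, such a strategy is a Resolution refutation of that width
(`isGame_of_closed`), and the number of narrow clauses bounds its size. -/

/-! ### Unambiguous certificates -/

/-- The designated certificates of `f` are certificates, and every input that is consistent with the
certificate of `x` has the same certificate as `x`. -/
structure Unambiguous (f : BoolFun) : Prop where
  eval_eq : ∀ x y, AgreeOn (f.cert x) x y → f.eval y = f.eval x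
  cert_eq : ∀ x y, AgreeOn (f.cert x) x y → f.cert y = f.cert x

/-- As long as all earlier values of `x` are `b`, the next position is inspected, so `y` has the
same value there; induct along the order. Taking all positions for `P` gives the value of AND or OR,
and the positions below `j` give the inspected set. -/
theorem prefix_agree {n : ℕ} {b : Bool} {x y : Fin n → Bool}
    (h : ∀ j, (∀ i < j, x i = b) → x j = y j) {P : Fin n → Prop}
    (hP : ∀ i j, i < j → P j → P i) :
    (∀ i, P i → x i = b) ↔ ∀ i, P i → y i = b := by
  have key : (∀ i, P i → y i = b) → ∀ i, P i → x i = b := by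
    intro hy i
    induction i using WellFoundedLT.induction with
    | ind i ih =>
      intro hi
      rw [h i fun j hj => ih j hj (hP j i hj hi), hy i hi]
  refine ⟨fun hx i hi => ?_, key⟩
  rw [← h i fun j hj => hx j (hP j i hj hi), hx i hi]

theorem unambiguous_andFun (n : ℕ) : Unambiguous (andFun n) := by
  constructor
  · intro x y h
    have h' : ∀ j, (∀ i < j, x i = true) → x j = y j := fun j hj => h j (by simpa using hj)
    have := prefix_agree h' (P := fun _ => True) (by simp)
    simp only [decide_eq_decide]
    simpa using this.symm
  · intro x y h
    have h' : ∀ j, (∀ i < j, x i = true) → x j = y j := fun j hj => h j (by simpa using hj)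
    ext j
    have := prefix_agree h' (P := fun i => i < j) (fun a b hab hb => hab.trans hb)
    simpa using this.symm

theorem unambiguous_orFun (n : ℕ) : Unambiguous (orFun n) := by
  constructor
  · intro x y h
    have h' : ∀ j, (∀ i < j, x i = false) → x j = y j := fun j hj => h j (by simpa using hj)
    have := prefix_agree h' (P := fun _ => True) (by simp)
    simp only [decide_eq_decide]
    rw [← not_iff_not]
    simpa using this.symm
  · intro x y h
    have h' : ∀ j, (∀ i < j, x i = false) → x j = y j := fun j hj => h j (by simpa using hj)
    ext j
    have := prefix_agree h' (P := fun i => i < j) (fun a b hab hb => hab.trans hb)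
    simpa using this.symm

theorem unambiguous_xorFun : Unambiguous xorFun := by
  constructor
  · intro x y h
    have h0 := h 0 (by simp)
    have h1 := h 1 (by simp)
    simp [h0, h1]
  · intro x y h
    rfl

theorem mem_comp_cert {f g : BoolFun} {x : (comp f g).Var → Bool} {p : (comp f g).Var} :
    p ∈ (comp f g).cert x ↔
      p.1 ∈ f.cert (fun i => g.eval fun j => x (i, j)) ∧ p.2 ∈ g.cert (fun j => x (p.1, j)) := by
  simp

theorem Unambiguous.comp {f g : BoolFun} (hf : Unambiguous f) (hg : Unambiguous g) :
    Unambiguous (comp f g) := by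
  have key : ∀ x y : (HittingRes.comp f g).Var → Bool,
      AgreeOn ((HittingRes.comp f g).cert x) x y →
      (∀ i ∈ f.cert (fun i => g.eval fun j => x (i, j)),
        AgreeOn (g.cert fun j => x (i, j)) (fun j => x (i, j)) (fun j => y (i, j))) := by
    intro x y h i hi j hj
    exact h (i, j) (mem_comp_cert.2 ⟨hi, hj⟩)
  have key2 : ∀ x y : (HittingRes.comp f g).Var → Bool,
      AgreeOn ((HittingRes.comp f g).cert x) x y →
      AgreeOn (f.cert (fun i => g.eval fun j => x (i, j)))
        (fun i => g.eval fun j => x (i, j)) (fun i => g.eval fun j => y (i, j)) := by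
    intro x y h i hi
    exact (hg.eval_eq _ _ (key x y h i hi)).symm
  constructor
  · intro x y h
    exact hf.eval_eq _ _ (key2 x y h)
  · intro x y h
    ext p
    rw [mem_comp_cert, mem_comp_cert, hf.cert_eq _ _ (key2 x y h)]
    refine and_congr_right fun hp => ?_
    rw [hg.cert_eq _ _ (key x y h p.1 hp)]

theorem IsCertificate.mono {V : Type} {f : (V → Bool) → Bool} {x : V → Bool} {S T : Finset V}
    (h : IsCertificate f x S) (hST : S ⊆ T) : IsCertificate f x T :=
  fun y hy => h y fun v hv => hy v (hST hv)

theorem IsCertificate.congr {V : Type} {f : (V → Bool) → Bool} {x y : V → Bool} {S : Finset V}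
    (hxy : AgreeOn S x y) (he : f y = f x) : IsCertificate f x S ↔ IsCertificate f y S := by
  constructor
  · intro h z hz
    rw [he]
    exact h z fun v hv => (hxy v hv).trans (hz v hv)
  · intro h z hz
    rw [← he]
    exact h z fun v hv => (hxy v hv).symm.trans (hz v hv)

section CheatSheet

variable {f : BoolFun}

theorem mem_cheatSheet_cert_inl {x : CheatVar f → Bool} {i : Fin (copies f)} {v : f.Var} :
    (Sum.inl (i, v) : CheatVar f) ∈ (cheatSheet f).cert x ↔
      v ∈ cellPositions x i ∨ (cheatEval f x = false ∧ v ∈ f.cert (copyInput x i)) := by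
  simp

theorem mem_cheatSheet_cert_inr {x : CheatVar f → Bool} {l : Fin (copies f) → Bool}
    {p : Fin (copies f) × Fin (certComplexity f.eval) × Fin (pointerBits f)} :
    (Sum.inr (l, p) : CheatVar f) ∈ (cheatSheet f).cert x ↔ l = address x := by
  simp

theorem cheatEval_eq_true_iff (x : CheatVar f → Bool) : cheatEval f x = true ↔
    ∀ i, IsCertificate f.eval (copyInput x i) (cellPositions x i) := by
  simp only [cheatEval, decide_eq_true_eq]

theorem cellPositions_congr {x y : CheatVar f → Bool} (ha : address y = address x)
    (hc : ∀ p, x (Sum.inr (address x, p)) = y (Sum.inr (address x, p))) (i : Fin (copies f)) :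
    cellPositions y i = cellPositions x i := by
  unfold cellPositions
  simp only [ha, hc]

theorem cheatEval_congr {x y : CheatVar f → Bool} (ha : address y = address x)
    (hc : ∀ p, x (Sum.inr (address x, p)) = y (Sum.inr (address x, p)))
    (hp : ∀ i, AgreeOn (cellPositions x i) (copyInput x i) (copyInput y i)) :
    cheatEval f y = cheatEval f x := by
  unfold cheatEval
  simp only [decide_eq_decide]
  refine forall_congr' fun i => ?_
  rw [cellPositions_congr ha hc i]
  exact (IsCertificate.congr (hp i) (congrFun ha i)).symm

/-- The point is that the certificate fixes the address. For a 0-input it contains certificates of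
all copies; for a 1-input the positions pointed to are themselves certificates of the copies. The
address fixes the cell, and hence the positions, the value and the certificate. -/
theorem Unambiguous.cheatSheet (hf : Unambiguous f) : Unambiguous (cheatSheet f) := by
  have key : ∀ x y : CheatVar f → Bool, AgreeOn ((HittingRes.cheatSheet f).cert x) x y →
      address y = address x ∧
      (∀ p, x (Sum.inr (address x, p)) = y (Sum.inr (address x, p))) ∧
      (∀ i, AgreeOn (cellPositions x i) (copyInput x i) (copyInput y i)) ∧
      (cheatEval f x = false → ∀ i, AgreeOn (f.cert (copyInput x i))
        (copyInput x i) (copyInput y i)) := by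
    intro x y h
    have h3 : ∀ i, AgreeOn (cellPositions x i) (copyInput x i) (copyInput y i) :=
      fun i v hv => h _ (mem_cheatSheet_cert_inl.2 (Or.inl hv))
    have h4 : cheatEval f x = false → ∀ i, AgreeOn (f.cert (copyInput x i))
        (copyInput x i) (copyInput y i) :=
      fun h0 i v hv => h _ (mem_cheatSheet_cert_inl.2 (Or.inr ⟨h0, hv⟩))
    refine ⟨?_, fun p => h _ (mem_cheatSheet_cert_inr.2 rfl), h3, h4⟩
    funext i
    cases h0 : cheatEval f x with
    | false => exact hf.eval_eq _ _ (h4 h0 i)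
    | true =>
      exact (cheatEval_eq_true_iff x).1 h0 i _ (h3 i)
  constructor
  · intro x y h
    obtain ⟨h1, h2, h3, -⟩ := key x y h
    exact cheatEval_congr h1 h2 h3
  · intro x y h
    obtain ⟨h1, h2, h3, h4⟩ := key x y h
    have he := cheatEval_congr h1 h2 h3
    ext p
    rcases p with ⟨i, v⟩ | ⟨l, p⟩
    · rw [mem_cheatSheet_cert_inl, mem_cheatSheet_cert_inl, cellPositions_congr h1 h2, he]
      refine or_congr_right (and_congr_right fun h0 => ?_)
      rw [hf.cert_eq _ _ (h4 h0 i)]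
    · rw [mem_cheatSheet_cert_inr, mem_cheatSheet_cert_inr, h1]

end CheatSheet

theorem unambiguous_akkFun (n k : ℕ) : Unambiguous (akkFun n k) := by
  induction k with
  | zero => exact unambiguous_andFun n
  | succ k ih =>
    exact (unambiguous_andFun n).comp ((unambiguous_orFun n).comp ih).cheatSheet

theorem unambiguous_xorAkk (k m : ℕ) : Unambiguous (xorAkk k m) :=
  (unambiguous_akkFun _ k).comp unambiguous_xorFun

/-! ### The partition formula is hitting and unsatisfiable -/

/-- The clause that excludes the designated certificate of `x`. -/
def certClause (f : BoolFun) (x : f.Var → Bool) : Clause f.Var :=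
  (f.cert x).image fun v => (v, !x v)

theorem mem_certClause {f : BoolFun} {x : f.Var → Bool} {l : Literal f.Var} :
    l ∈ certClause f x ↔ l.1 ∈ f.cert x ∧ l.2 = !x l.1 := by
  obtain ⟨v, b⟩ := l
  simp only [certClause, Finset.mem_image, Prod.mk.injEq]
  constructor
  · rintro ⟨w, hw, rfl, rfl⟩
    exact ⟨hw, rfl⟩
  · rintro ⟨h, rfl⟩
    exact ⟨v, h, rfl, rfl⟩

theorem mem_partitionCNF {f : BoolFun} {C : Clause f.Var} :
    C ∈ partitionCNF f ↔ ∃ x, C = certClause f x := by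
  have h : ∀ x, negTerm ((f.cert x).image fun v => (v, x v)) = certClause f x := by
    intro x
    simp [negTerm, certClause, Finset.image_image, Function.comp_def]
  simp only [partitionCNF, dnfTerms, ← Finset.image_union, ← Finset.filter_or, Finset.mem_image,
    Finset.mem_filter, Finset.mem_univ, true_and]
  constructor
  · rintro ⟨_, ⟨x, -, rfl⟩, rfl⟩
    exact ⟨x, h x⟩
  · rintro ⟨x, rfl⟩
    exact ⟨_, ⟨x, by cases f.eval x <;> simp, rfl⟩, h x⟩

theorem unsat_partitionCNF (f : BoolFun) : Unsat (partitionCNF f) := by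
  intro x
  refine ⟨_, mem_partitionCNF.2 ⟨x, rfl⟩, fun l hl => ?_⟩
  rw [(mem_certClause.1 hl).2]
  cases x l.1 <;> simp

/-- Without contrary literals the two partial inputs can be glued to one input `z`, whose
certificate equals both. -/
theorem Unambiguous.isHitting {f : BoolFun} (hf : Unambiguous f) : IsHitting (partitionCNF f) := by
  intro C hC D hD hCD
  obtain ⟨x, rfl⟩ := mem_partitionCNF.1 hC
  obtain ⟨y, rfl⟩ := mem_partitionCNF.1 hD
  by_contra hcon
  push Not at hcon
  have hag : ∀ v, v ∈ f.cert x → v ∈ f.cert y → x v = y v := by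
    intro v hx hy
    by_contra hne
    refine hcon v (!x v) (mem_certClause.2 ⟨hx, rfl⟩) (mem_certClause.2 ⟨hy, ?_⟩)
    revert hne
    cases x v <;> cases y v <;> simp
  let z : f.Var → Bool := fun v => if v ∈ f.cert x then x v else y v
  have hxz : AgreeOn (f.cert x) x z := fun v hv => by simp [z, hv]
  have hyz : AgreeOn (f.cert y) y z := fun v hv => by
    by_cases h : v ∈ f.cert x
    · simp [z, h, hag v h hv]
    · simp [z, h]
  have hcert : f.cert x = f.cert y := (hf.cert_eq _ _ hxz).symm.trans (hf.cert_eq _ _ hyz)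
  apply hCD
  ext l
  rw [mem_certClause, mem_certClause, ← hcert]
  refine and_congr_right fun hl => ?_
  rw [hag l.1 hl (hcert ▸ hl)]

/-! ### Deterministic query complexity -/

section QueryDepth

variable {V : Type} [DecidableEq V]

/-- `f` can be evaluated with at most `d` queries. -/
def Decides : ℕ → ((V → Bool) → Bool) → Prop
  | 0, f => ∀ x y, f x = f y
  | d + 1, f => (∀ x y, f x = f y) ∨ ∃ v, ∀ b, Decides d fun x => f (Function.update x v b)

theorem decides_of_const {f : (V → Bool) → Bool} (h : ∀ x y, f x = f y) (d : ℕ) : Decides d f := by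
  cases d with
  | zero => exact h
  | succ d => exact Or.inl h

theorem Decides.mono {d e : ℕ} {f : (V → Bool) → Bool} (h : Decides d f) (hde : d ≤ e) :
    Decides e f := by
  induction d generalizing e f with
  | zero => exact decides_of_const h e
  | succ d ih =>
    obtain ⟨e, rfl⟩ : ∃ e', e = e' + 1 := ⟨e - 1, by omega⟩
    rcases h with h | ⟨v, h⟩
    · exact Or.inl h
    · exact Or.inr ⟨v, fun b => ih (h b) (by omega)⟩

theorem Decides.not {d : ℕ} {f : (V → Bool) → Bool} (h : Decides d f) :
    Decides d fun x => !f x := by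
  induction d generalizing f with
  | zero => exact fun x y => congrArg _ (h x y)
  | succ d ih =>
    rcases h with h | ⟨v, h⟩
    · exact Or.inl fun x y => congrArg _ (h x y)
    · exact Or.inr ⟨v, fun b => ih (h b)⟩

theorem decides_card_of_dependsOn {f : (V → Bool) → Bool} {S : Finset V}
    (h : ∀ x y, AgreeOn S x y → f x = f y) : Decides S.card f := by
  induction hn : S.card generalizing S f with
  | zero =>
    obtain rfl := Finset.card_eq_zero.1 hn
    exact fun x y => h x y (by simp [AgreeOn])
  | succ n ih =>
    obtain ⟨v, hv⟩ := Finset.card_pos.1 (by omega : 0 < S.card)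
    refine Or.inr ⟨v, fun b => ih (S := S.erase v) (fun x y hxy => h _ _ fun w hw => ?_) ?_⟩
    · by_cases hwv : w = v
      · subst hwv
        simp
      · simp only [Function.update_of_ne hwv]
        exact hxy w (Finset.mem_erase.2 ⟨hwv, hw⟩)
    · rw [Finset.card_erase_of_mem hv, hn, Nat.add_sub_cancel]

/-- The deterministic query complexity. -/
noncomputable def queryDepth (f : (V → Bool) → Bool) : ℕ := sInf {d | Decides d f}

theorem queryDepth_le {f : (V → Bool) → Bool} {d : ℕ} (h : Decides d f) : queryDepth f ≤ d :=
  Nat.sInf_le h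

variable [Fintype V]

theorem decides_queryDepth (f : (V → Bool) → Bool) : Decides (queryDepth f) f :=
  Nat.sInf_mem (s := {d | Decides d f})
    ⟨_, decides_card_of_dependsOn (S := Finset.univ) fun _ _ h =>
      congrArg f (funext fun v => h v (Finset.mem_univ v))⟩

theorem queryDepth_le_card (f : (V → Bool) → Bool) : queryDepth f ≤ Fintype.card V :=
  queryDepth_le (decides_card_of_dependsOn (S := Finset.univ) fun _ _ h =>
      congrArg f (funext fun v => h v (Finset.mem_univ v)))

theorem exists_eq_of_queryDepth_pos {f : (V → Bool) → Bool} (h : 0 < queryDepth f) (b : Bool) :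
    ∃ x, f x = b := by
  by_contra hcon
  push Not at hcon
  refine absurd (queryDepth_le (d := 0) (f := f) fun x y => ?_) (by omega)
  have hx := hcon x
  have hy := hcon y
  revert hx hy
  cases f x <;> cases f y <;> cases b <;> simp

theorem queryDepth_le_succ (f : (V → Bool) → Bool) (v : V) {d : ℕ}
    (h : ∀ b, queryDepth (fun x => f (Function.update x v b)) ≤ d) : queryDepth f ≤ d + 1 :=
  queryDepth_le (Or.inr ⟨v, fun b => (decides_queryDepth _).mono (h b)⟩)

theorem queryDepth_not (f : (V → Bool) → Bool) :
    queryDepth (fun x => !f x) = queryDepth f := by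
  refine le_antisymm (queryDepth_le (decides_queryDepth f).not) ?_
  have h := (decides_queryDepth fun x => !f x).not
  simp only [Bool.not_not] at h
  exact queryDepth_le h

/-- An answer to a query that keeps the query complexity high. -/
theorem exists_answer (f : (V → Bool) → Bool) (v : V) :
    ∃ b, queryDepth f ≤ queryDepth (fun x => f (Function.update x v b)) + 1 := by
  by_contra hcon
  push Not at hcon
  -- If both answers cost at least 2, then querying `v` first saves one query overall. The
  -- subtraction is not truncated, as `hcon` forces `queryDepth f` to be at least 2.
  have := queryDepth_le_succ f v (d := queryDepth f - 2) fun b => by have := hcon b; omega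
  have := hcon true
  omega

/-- The same for a satisfiable function, which remains satisfiable. -/
theorem exists_answer_sat {f : (V → Bool) → Bool} (hf : ∃ x, f x = true) (v : V) :
    ∃ b, (∃ x, f (Function.update x v b) = true) ∧
      queryDepth f ≤ queryDepth (fun x => f (Function.update x v b)) + 1 := by
  obtain ⟨b, hb⟩ := exists_answer f v
  by_cases hs : ∃ x, f (Function.update x v b) = true
  · exact ⟨b, hs, hb⟩
  -- The good answer makes `f` unsatisfiable only if `queryDepth f` is at most 1. Then every answer
  -- is good enough, in particular the one taken from a satisfying input.
  · push Not at hs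
    have h0 : queryDepth (fun x => f (Function.update x v b)) = 0 :=
      Nat.le_zero.1 <| queryDepth_le fun x y => by
        rw [Bool.eq_false_iff.2 (hs x), Bool.eq_false_iff.2 (hs y)]
    obtain ⟨x, hx⟩ := hf
    refine ⟨x v, ⟨x, by rw [Function.update_eq_self]; exact hx⟩, by omega⟩

end QueryDepth

/-! ### Query complexity of compositions with AND and OR -/

section Composition

variable {ι V : Type} [Fintype ι] [DecidableEq ι] [Fintype V] [DecidableEq V]

/-- An adversary answers each query inside its block by `exists_answer_sat`: the block stays
satisfiable and loses at most 1, so the sum drops by at most 1 per query. The blocks may differ, so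
that the induction can restrict one of them. -/
theorem sum_queryDepth_le_of_decides_and {d : ℕ} {g : ι → (V → Bool) → Bool}
    {F : (ι × V → Bool) → Bool} (hF : ∀ x, F x = true ↔ ∀ i, g i (fun j => x (i, j)) = true)
    (hg : ∀ i, ∃ x, g i x = true) (h : Decides d F) :
    ∑ i, queryDepth (g i) ≤ d := by
  -- If `F` is constant, it is true, by a satisfying input in each block. Replacing one block of
  -- this input arbitrarily shows that the function on that block is constant as well.
  have const : ∀ (g : ι → (V → Bool) → Bool) (F : (ι × V → Bool) → Bool),
      (∀ x, F x = true ↔ ∀ i, g i (fun j => x (i, j)) = true) →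
      (∀ i, ∃ x, g i x = true) → (∀ x y, F x = F y) → ∑ i, queryDepth (g i) = 0 := by
    intro g F hF hg hc
    choose x hx using hg
    refine Finset.sum_eq_zero fun i _ => Nat.le_zero.1 (queryDepth_le fun y z => ?_)
    have key : ∀ y, g i y = true := by
      intro y
      have h1 : F (fun p => x p.1 p.2) = true := (hF _).2 hx
      rw [hc _ fun p => Function.update x i y p.1 p.2] at h1
      simpa using (hF _).1 h1 i
    rw [key, key]
  induction d generalizing g F with
  | zero => exact (const g F hF hg h).le
  | succ d ih =>
    rcases h with h | ⟨⟨i, j⟩, h⟩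
    · exact (const g F hF hg h).le.trans (Nat.zero_le _)
    · obtain ⟨b, hs, hb⟩ := exists_answer_sat (hg i) j
      have hupd : ∀ x : ι × V → Bool, ∀ i', Function.update g i
          (fun z => g i (Function.update z j b)) i' (fun j' => x (i', j')) =
          g i' (fun j' => Function.update x (i, j) b (i', j')) := by
        intro x i'
        by_cases hi : i' = i
        · subst hi
          rw [Function.update_self]
          congr 1
          funext j'
          by_cases hj : j' = j
          · subst hj; simp
          · rw [Function.update_of_ne hj, Function.update_of_ne (by simpa using hj)]
        · rw [Function.update_of_ne hi]
          congr 1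
          funext j'
          rw [Function.update_of_ne (by simp [hi])]
      have key := ih (g := Function.update g i fun z => g i (Function.update z j b))
        (F := fun x => F (Function.update x (i, j) b)) (fun x => by simp only [hF, hupd]) (by
        intro i'
        by_cases hi : i' = i
        · subst hi; simpa using hs
        · simpa [hi] using hg i') (h b)
      rw [← Finset.add_sum_erase _ _ (Finset.mem_univ i)] at key ⊢
      rw [Function.update_self] at key
      rw [Finset.sum_congr rfl fun i' hi' => by
        rw [Function.update_of_ne (Finset.ne_of_mem_erase hi')]] at key
      omega

end Composition

/-- The deterministic query complexity of a function with designated certificates. -/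
noncomputable def BoolFun.depth (f : BoolFun) : ℕ := queryDepth f.eval

theorem BoolFun.depth_eq (f : BoolFun) [inst : DecidableEq f.Var] :
    f.depth = @queryDepth f.Var inst f.eval := by
  rw [BoolFun.depth, Subsingleton.elim f.decEqVar inst]

theorem mul_depth_le_comp_andFun (n : ℕ) (g : BoolFun) :
    n * g.depth ≤ (comp (andFun n) g).depth := by
  rcases Nat.eq_zero_or_pos g.depth with h0 | h0
  · simp [h0]
  · have := sum_queryDepth_le_of_decides_and (g := fun _ : Fin n => g.eval)
      (fun x => by simp) (fun _ => exists_eq_of_queryDepth_pos h0 true)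
      (decides_queryDepth (comp (andFun n) g).eval)
    simp only [Finset.sum_const, Finset.card_univ, Fintype.card_fin, smul_eq_mul] at this
    exact this

theorem mul_depth_le_comp_orFun (n : ℕ) (g : BoolFun) :
    n * g.depth ≤ (comp (orFun n) g).depth := by
  rcases Nat.eq_zero_or_pos g.depth with h0 | h0
  · simp [h0]
  · have := sum_queryDepth_le_of_decides_and (g := fun _ : Fin n => fun x => !g.eval x)
      (fun x => by simp) (fun _ => by
        obtain ⟨x, hx⟩ := exists_eq_of_queryDepth_pos h0 false
        exact ⟨x, by simp [hx]⟩) (decides_queryDepth (comp (orFun n) g).eval).not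
    simp only [queryDepth_not, Finset.sum_const, Finset.card_univ, Fintype.card_fin,
      smul_eq_mul] at this
    exact this

/-- AND_n is its own composition with the identity on one bit, which has query complexity at least
1. -/
theorem le_depth_andFun (n : ℕ) : n ≤ (andFun n).depth := by
  have h1 : 0 < queryDepth fun x : Unit → Bool => x () := by
    by_contra hcon
    have h2 := decides_queryDepth fun x : Unit → Bool => x ()
    rw [Nat.eq_zero_of_not_pos hcon] at h2
    exact absurd (h2 (fun _ => true) fun _ => false) (by simp)
  have h2 : ∀ (d : ℕ) (F : (Fin n → Bool) → Bool), Decides d F →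
      Decides d fun x : Fin n × Unit → Bool => F fun i => x (i, ()) := by
    intro d
    induction d with
    | zero => exact fun F hF x y => hF _ _
    | succ d ih =>
      rintro F (hF | ⟨v, hF⟩)
      · exact Or.inl fun x y => hF _ _
      · refine Or.inr ⟨(v, ()), fun b => ?_⟩
        convert ih _ (hF b) using 4 with x i
        by_cases hi : i = v
        · subst hi; simp
        · simp [hi]
  have h3 := sum_queryDepth_le_of_decides_and (g := fun _ : Fin n => fun x : Unit → Bool => x ())
    (fun x => by simp) (fun _ => exists_eq_of_queryDepth_pos h1 true)
    (h2 _ _ (decides_queryDepth (andFun n).eval))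
  simp only [Finset.sum_const, Finset.card_univ, Fintype.card_fin, smul_eq_mul] at h3
  exact (Nat.le_mul_of_pos_right n h1).trans h3

/-! ### Partial assignments -/

section Fill

variable {V : Type}

/-- The input that agrees with the partial assignment `ρ`, and with `x` elsewhere. -/
def fill (ρ : V → Option Bool) (x : V → Bool) : V → Bool := fun v => (ρ v).getD (x v)

theorem fill_none (x : V → Bool) : fill (fun _ => none) x = x := rfl

variable [DecidableEq V]

theorem fill_update_of_some {ρ : V → Option Bool} {v : V} {b : Bool} (h : ρ v = some b)
    (x : V → Bool) (b' : Bool) : fill ρ (Function.update x v b') = fill ρ x := by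
  funext w
  by_cases hw : w = v
  · subst hw; simp [fill, h]
  · simp [fill, hw]

theorem fill_update_of_none {ρ : V → Option Bool} {v : V} (h : ρ v = none)
    (x : V → Bool) (b : Bool) :
    fill ρ (Function.update x v b) = fill (Function.update ρ v (some b)) x := by
  funext w
  by_cases hw : w = v
  · subst hw; simp [fill, h]
  · simp [fill, hw]

end Fill

/-! ### Cheat sheets are as hard as the function -/

section CheatSheet

variable {f : BoolFun}

theorem exists_certificate_card_le (f : BoolFun) (x : f.Var → Bool) :
    ∃ S : Finset f.Var, S.card ≤ certComplexity f.eval ∧ IsCertificate f.eval x S := by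
  have hne : {s : ℕ | ∃ S : Finset f.Var, S.card = s ∧ IsCertificate f.eval x S}.Nonempty :=
    ⟨_, Finset.univ, rfl, fun y hy => by
      rw [show y = x from funext fun v => (hy v (Finset.mem_univ v)).symm]⟩
  obtain ⟨S, hS, hc⟩ := Nat.sInf_mem hne
  refine ⟨S, ?_, hc⟩
  rw [hS]
  exact Finset.le_sup (f := fun x : f.Var → Bool =>
    sInf {s : ℕ | ∃ S : Finset f.Var, S.card = s ∧ IsCertificate f.eval x S}) (Finset.mem_univ x)

theorem exists_decodePointer (f : BoolFun) (v : f.Var) :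
    ∃ b, decodePointer f b = some v := by
  refine ⟨fun j => (Fintype.equivFin f.Var v : ℕ).testBit j, ?_⟩
  have h : Nat.ofBits (fun j : Fin (pointerBits f) => (Fintype.equivFin f.Var v : ℕ).testBit j) =
      Fintype.equivFin f.Var v := by
    rw [Nat.ofBits_testBit, Nat.mod_eq_of_lt]
    exact (Fintype.equivFin f.Var v).2.trans_le (Nat.le_pow_clog one_lt_two _)
  unfold decodePointer
  simp [h]

theorem exists_pointers (f : BoolFun) (x : f.Var → Bool) :
    ∃ Y, IsCertificate f.eval x (pointedSet f Y) := by
  obtain ⟨S, hS, hc⟩ := exists_certificate_card_le f x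
  choose e he using exists_decodePointer f
  -- Surplus pointers may be arbitrary: they can only enlarge the certificate.
  refine ⟨fun s => if h : (s : ℕ) < S.card then e (S.equivFin.symm ⟨s, h⟩) else fun _ => false,
    hc.mono fun v hv => ?_⟩
  have hlt := (S.equivFin ⟨v, hv⟩).2
  refine Finset.mem_filter.2 ⟨Finset.mem_univ _, ⟨S.equivFin ⟨v, hv⟩, hlt.trans_le hS⟩, ?_⟩
  simp [he]

theorem card_pointedSet_const_le_one (f : BoolFun) (b : Fin (pointerBits f) → Bool) :
    (pointedSet f fun _ => b).card ≤ 1 := by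
  refine Finset.card_le_one.2 fun v hv w hw => ?_
  simp only [pointedSet, Finset.mem_filter, Finset.mem_univ, true_and] at hv hw
  obtain ⟨_, hv⟩ := hv
  obtain ⟨_, hw⟩ := hw
  exact Option.some_injective _ (hv.symm.trans hw)

/-- Value 1: choose an address outside `T`, give the copies these values and write certificates into
the untouched cell. Value 0: fill all cells with zeros, so that a cell points to at most one
variable of a copy. If that were always a certificate, one query would decide the restricted copy,
against `hρ`. -/
theorem cheatEval_fill_not_const (hc : 0 < copies f) {ρ : CheatVar f → Option Bool}
    {T : Finset (Fin (copies f) → Bool)}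
    (hρ : ∀ i, 2 ≤ queryDepth fun z => f.eval (fill (fun v => ρ (Sum.inl (i, v))) z))
    (hcell : ∀ p, ρ (Sum.inr p) = none ∨ ρ (Sum.inr p) = some false)
    (hT : ∀ l ∉ T, ∀ p, ρ (Sum.inr (l, p)) = none) (hcard : T.card < 2 ^ copies f) :
    ¬ ∀ x y, cheatEval f (fill ρ x) = cheatEval f (fill ρ y) := by
  intro hconst
  have h1 : ∃ x, cheatEval f (fill ρ x) = true := by
    obtain ⟨l, hl⟩ : ∃ l, l ∉ T := by
      by_contra hcon
      push Not at hcon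
      rw [Finset.eq_univ_iff_forall.2 hcon] at hcard
      simp at hcard
    have hz : ∀ i, ∃ z, f.eval (fill (fun v => ρ (Sum.inl (i, v))) z) = l i := fun i =>
      exists_eq_of_queryDepth_pos (two_pos.trans_le (hρ i)) (l i)
    choose z hz using hz
    have hY := fun i => exists_pointers f (fill (fun v => ρ (Sum.inl (i, v))) (z i))
    choose Y hY using hY
    let x : CheatVar f → Bool := Sum.elim (fun p => z p.1 p.2) fun p => Y p.2.1 p.2.2.1 p.2.2.2
    have hx : ∀ i, copyInput (fill ρ x) i = fill (fun v => ρ (Sum.inl (i, v))) (z i) :=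
      fun i => rfl
    have ha : address (fill ρ x) = l := by
      funext i
      simp only [address, hx, hz]
    refine ⟨x, ?_⟩
    refine (cheatEval_eq_true_iff _).2 fun i => ?_
    have hp : cellPositions (fill ρ x) i = pointedSet f (Y i) := by
      unfold cellPositions
      rw [ha]
      simp [fill, hT l hl, x]
    rw [hp, hx]
    exact hY i
  have h0 : ∃ x, cheatEval f (fill ρ x) = false := by
    by_contra hcon
    push Not at hcon
    let i : Fin (copies f) := ⟨0, hc⟩
    let S := pointedSet f fun _ _ => false
    have hcert : ∀ z, IsCertificate f.eval (fill (fun v => ρ (Sum.inl (i, v))) z) S := by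
      intro z
      let x : CheatVar f → Bool := Sum.elim (fun p => z p.2) fun _ => false
      have h := (cheatEval_eq_true_iff _).1 (Bool.eq_true_of_not_eq_false (hcon x)) i
      have hp : cellPositions (fill ρ x) i = S := by
        unfold cellPositions
        congr 1
        funext s j
        rcases hcell (address (fill ρ x), i, s, j) with h | h <;> simp [fill, h, x]
      rwa [hp] at h
    refine absurd (queryDepth_le ((decides_card_of_dependsOn (S := S) fun y z hyz => ?_).mono
      (card_pointedSet_const_le_one f _))) (not_le.2 (hρ i))
    refine (hcert y _ fun v hv => ?_).symm
    simp [fill, hyz v hv]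
  obtain ⟨x, hx⟩ := h1
  obtain ⟨y, hy⟩ := h0
  simpa [hx, hy] using hconst x y

/-- The adversary answers 0 in cells, which touches at most one new cell, and uses `exists_answer`
in the copies, which costs one copy at most 1. The slack in `hρ` and `hcard` is such that after `d`
queries every copy still has complexity at least 2 and some cell is untouched. -/
theorem not_decides_cheatEval_fill (hc : 0 < copies f) {d : ℕ} {ρ : CheatVar f → Option Bool}
    {T : Finset (Fin (copies f) → Bool)}
    (hρ : ∀ i, d + 2 ≤ queryDepth fun z => f.eval (fill (fun v => ρ (Sum.inl (i, v))) z))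
    (hcell : ∀ p, ρ (Sum.inr p) = none ∨ ρ (Sum.inr p) = some false)
    (hT : ∀ l ∉ T, ∀ p, ρ (Sum.inr (l, p)) = none) (hcard : T.card + d < 2 ^ copies f) :
    ¬ Decides d fun x => cheatEval f (fill ρ x) := by
  induction d generalizing ρ T with
  | zero => exact cheatEval_fill_not_const hc hρ hcell hT hcard
  | succ d ih =>
    rintro (h | ⟨v, h⟩)
    · exact cheatEval_fill_not_const hc (fun i => le_trans (by omega) (hρ i)) hcell hT
        (by omega) h
    cases hv : ρ v with
    | some b =>
      refine ih (fun i => le_trans (by omega) (hρ i)) hcell hT (by omega) ?_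
      simpa only [fill_update_of_some hv] using h b
    | none =>
      simp only [fill_update_of_none hv] at h
      rcases v with ⟨i, v⟩ | ⟨l, p⟩
      · obtain ⟨b, hb⟩ := exists_answer
          (fun z => f.eval (fill (fun v => ρ (Sum.inl (i, v))) z)) v
        have hcopy : ∀ i', (fun w => Function.update ρ (Sum.inl (i, v)) (some b)
            (Sum.inl (i', w))) = if i' = i then
              Function.update (fun w => ρ (Sum.inl (i, w))) v (some b) else
              fun w => ρ (Sum.inl (i', w)) := by
          intro i'
          funext w
          by_cases hi : i' = i
          · subst hi
            by_cases hw : w = v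
            · subst hw; simp
            · simp [hw]
          · simp [hi]
        refine ih (T := T) (fun i' => ?_) (fun p => by simpa using hcell p)
          (fun l hl p => by simpa using hT l hl p) (by omega) (h b)
        rw [hcopy]
        by_cases hi : i' = i
        · subst hi
          have := hρ i'
          simp only [fill_update_of_none (ρ := fun w => ρ (Sum.inl (i', w))) hv] at hb
          simp only [if_true]
          omega
        · simp only [hi, if_false]
          exact le_trans (by omega) (hρ i')
      · refine ih (T := insert l T) (fun i' => ?_) (fun p' => ?_) (fun l' hl' p' => ?_) ?_ (h false)
        · simpa using le_trans (by omega : d + 2 ≤ d + 1 + 2) (hρ i')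
        · by_cases hp : p' = (l, p)
          · subst hp; simp
          · simpa [hp] using hcell p'
        · simp only [Finset.mem_insert, not_or] at hl'
          rw [Function.update_of_ne (by simp [hl'.1])]
          exact hT l' hl'.2 p'
        · have := Finset.card_insert_le l T
          omega

/-- There are 2^c ≥ N cells, more than a too shallow decision tree can touch; the loss of 1 comes
from the 2 in `not_decides_cheatEval_fill`. -/
theorem depth_le_cheatSheet (f : BoolFun) : f.depth ≤ (cheatSheet f).depth + 1 := by
  by_contra hcon
  have hN : f.depth ≤ _ := queryDepth_le_card f.eval
  have hL : 0 < pointerBits f := Nat.clog_pos one_lt_two (by omega)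
  have hpow : Fintype.card f.Var ≤ 2 ^ copies f :=
    (Nat.le_pow_clog one_lt_two _).trans
      (Nat.pow_le_pow_right two_pos (by unfold copies pointerBits; omega))
  refine not_decides_cheatEval_fill (f := f) (ρ := fun _ => none) (T := ∅)
    (d := (cheatSheet f).depth) (by unfold copies; omega) (fun i => ?_) (by simp)
    (by simp) ?_ ?_
  · simp only [fill_none]
    change _ ≤ f.depth
    omega
  · simp only [Finset.card_empty]
    omega
  · simp only [fill_none]
    rw [(cheatSheet f).depth_eq]
    exact decides_queryDepth (cheatSheet f).eval

end CheatSheet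

theorem pow_le_depth_akkFun {n : ℕ} (hn : 2 ≤ n) (k : ℕ) :
    n ^ (2 * k + 1) ≤ 2 ^ k * (akkFun n k).depth := by
  induction k with
  | zero =>
    rw [pow_zero, one_mul, mul_zero, zero_add, pow_one]
    exact le_depth_andFun n
  | succ k ih =>
    set D := (akkFun n k).depth
    have h1 : n * D ≤ _ := mul_depth_le_comp_orFun n (akkFun n k)
    have h2 := depth_le_cheatSheet (comp (orFun n) (akkFun n k))
    have h3 := mul_depth_le_comp_andFun n (cheatSheet (comp (orFun n) (akkFun n k)))
    set E := (cheatSheet (comp (orFun n) (akkFun n k))).depth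
    have hD : 0 < D := by
      by_contra h0
      have : 0 < n ^ (2 * k + 1) := by positivity
      rw [Nat.eq_zero_of_not_pos h0] at ih
      omega
    -- The additive loss of the cheat sheet is absorbed into a factor 2, at each of the `k` levels.
    have h4 : n * D ≤ 2 * E := by
      have : 2 * 1 ≤ n * D := Nat.mul_le_mul hn hD
      omega
    calc n ^ (2 * (k + 1) + 1) = n * (n * n ^ (2 * k + 1)) := by ring
      _ ≤ n * (n * (2 ^ k * D)) := by gcongr
      _ = 2 ^ k * (n * (n * D)) := by ring
      _ ≤ 2 ^ k * (n * (2 * E)) := by gcongr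
      _ = 2 ^ (k + 1) * (n * E) := by ring
      _ ≤ _ := Nat.mul_le_mul_left _ h3

/-! ### Tree-like Resolution and queries -/

section TreeLike

variable {V : Type}

theorem TreeResDerivation.pos [DecidableEq V] {F : CNF V} {C : Clause V} {s : ℕ}
    (h : TreeResDerivation F C s) : 0 < s := by
  cases h <;> omega

/-- The parities that are determined by a partial assignment to pairs of bits. -/
def parities (ρ : V × Fin 2 → Option Bool) (i : V) : Option Bool :=
  (ρ (i, 0)).bind fun a => (ρ (i, 1)).map fun b => xor a b

/-- The pairs of bits of which exactly one is assigned. -/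
def halfSet [Fintype V] (ρ : V × Fin 2 → Option Bool) : Finset V :=
  Finset.univ.filter fun i => (ρ (i, 0)).isSome ≠ (ρ (i, 1)).isSome

/-- In a pair whose parity is not determined, a free bit adjusts the parity to any prescribed value.
-/
theorem exists_extension_of_parities (ρ : V × Fin 2 → Option Bool) (z : V → Bool) :
    ∃ x : V × Fin 2 → Bool, (∀ p b, ρ p = some b → x p = b) ∧
      (fun i => xor (x (i, 0)) (x (i, 1))) = fill (parities ρ) z := by
  have h : ∀ i, ∃ y : Fin 2 → Bool, (∀ j b, ρ (i, j) = some b → y j = b) ∧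
      xor (y 0) (y 1) = fill (parities ρ) z i := by
    intro i
    cases h0 : ρ (i, 0) with
    | none =>
      refine ⟨![xor (z i) ((ρ (i, 1)).getD false), (ρ (i, 1)).getD false], ?_, ?_⟩
      · intro j b hj
        fin_cases j
        · simp [h0] at hj
        · simp at hj; simp [hj]
      · simp [fill, parities, h0]
    | some a =>
      cases h1 : ρ (i, 1) with
      | none =>
        refine ⟨![a, xor a (z i)], ?_, ?_⟩
        · intro j b hj
          fin_cases j
          · simp [h0] at hj; simp [hj]
          · simp [h1] at hj
        · simp [fill, parities, h0, h1]
      | some b =>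
        refine ⟨![a, b], ?_, ?_⟩
        · intro j b' hj
          fin_cases j
          · simp [h0] at hj; simp [hj]
          · simp [h1] at hj; simp [hj]
        · simp [fill, parities, h0, h1]
  choose y hy hy' using h
  exact ⟨fun p => y p.1 p.2, fun p b => hy p.1 p.2 b, funext hy'⟩

variable [DecidableEq V]

theorem parities_update_of_none {ρ : V × Fin 2 → Option Bool} {i : V} {j : Fin 2}
    (ho : ρ (i, 1 - j) = none) (b : Bool) (hv : ρ (i, j) = none) :
    parities (Function.update ρ (i, j) (some b)) = parities ρ := by
  funext i'
  by_cases hi : i' = i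
  · subst hi
    fin_cases j <;> simp at ho hv <;> simp [parities, ho, hv]
  · simp [parities, hi]

theorem parities_update_of_some {ρ : V × Fin 2 → Option Bool} {i : V} {j : Fin 2} {a : Bool}
    (ho : ρ (i, 1 - j) = some a) (b : Bool) :
    parities (Function.update ρ (i, j) (some (xor b a))) =
      Function.update (parities ρ) i (some b) := by
  funext i'
  by_cases hi : i' = i
  · subst hi
    fin_cases j <;> simp at ho <;> cases a <;> cases b <;> simp [parities, ho]
  · simp [parities, hi]

variable [Fintype V]

theorem halfSet_update_of_none {ρ : V × Fin 2 → Option Bool} {i : V} {j : Fin 2}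
    (ho : ρ (i, 1 - j) = none) (hv : ρ (i, j) = none) (b : Bool) :
    (halfSet (Function.update ρ (i, j) (some b))).card = (halfSet ρ).card + 1 := by
  have hi : i ∉ halfSet ρ := by
    fin_cases j <;> simp at ho hv <;> simp [halfSet, ho, hv]
  rw [← Finset.card_insert_of_notMem hi]
  congr 1
  ext i'
  by_cases hi : i' = i
  · subst hi
    fin_cases j <;> simp at ho <;> simp [halfSet, ho]
  · simp [halfSet, hi]

theorem halfSet_update_of_some {ρ : V × Fin 2 → Option Bool} {i : V} {j : Fin 2} {a : Bool}
    (ho : ρ (i, 1 - j) = some a) (hv : ρ (i, j) = none) (b : Bool) :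
    (halfSet (Function.update ρ (i, j) (some b))).card + 1 = (halfSet ρ).card := by
  have hi : i ∈ halfSet ρ := by
    fin_cases j <;> simp at ho hv <;> simp [halfSet, ho, hv]
  rw [← Finset.card_erase_add_one hi]
  congr 2
  ext i'
  by_cases hi : i' = i
  · subst hi
    fin_cases j <;> simp at ho <;> simp [halfSet, ho]
  · simp [halfSet, hi]

/-- Descend from `C` towards an initial clause, keeping the current clause falsified by `ρ`. If the
pivot is the first assigned bit of its pair, no parity is determined, so one may go to the smaller
subderivation: `e` drops by 1 and `halfSet` grows by 1. If it is the second bit, query the parity of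
the pair, which is paid for by the drop of `halfSet`. At an initial clause the value of `f` is
determined. -/
theorem decides_fill_parities {f : (V → Bool) → Bool} {F : CNF (V × Fin 2)}
    (hF : ∀ C ∈ F, ∃ b, ∀ x, Falsifies x C → f (fun i => xor (x (i, 0)) (x (i, 1))) = b)
    {C : Clause (V × Fin 2)} {s : ℕ} (hC : TreeResDerivation F C s) {e : ℕ}
    {ρ : V × Fin 2 → Option Bool} (hρ : ∀ l ∈ C, ρ l.1 = some (!l.2)) (hs : s < 2 ^ (e + 1)) :
    Decides (e + (halfSet ρ).card) fun z => f (fill (parities ρ) z) := by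
  induction hC generalizing e ρ with
  | @initial C hC =>
    obtain ⟨b, hb⟩ := hF C hC
    have key : ∀ z, f (fill (parities ρ) z) = b := by
      intro z
      obtain ⟨x, hx, hxz⟩ := exists_extension_of_parities ρ z
      rw [← hxz]
      refine hb x fun l hl => ?_
      rw [hx _ _ (hρ l hl)]
      cases l.2 <;> simp
    exact decides_of_const (fun y z => by rw [key, key]) _
  | @resolve C D R s t hC hD hR ihC ihD =>
    obtain ⟨⟨i, j⟩, hvC, hvD, rfl⟩ := hR
    -- If `C` contains both literals of the pivot, the negative one survives in the resolvent, and
    -- so `ρ` already sets the pivot to `true`. The hypothesis on `ρ (i, j)` excludes this.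
    have hC' : ∀ {σ : V × Fin 2 → Option Bool}, ρ (i, j) ≠ some true → σ (i, j) = some false →
        (∀ p ≠ (i, j), σ p = ρ p) → ∀ l ∈ C, σ l.1 = some (!l.2) := by
      rintro σ hv hσ hσρ ⟨p, b⟩ hl
      by_cases hp : p = (i, j)
      · subst hp
        cases b with
        | true => exact hσ
        | false => exact absurd (hρ ((i, j), false) (by simp [hl])) hv
      · rw [hσρ p hp]
        exact hρ (p, b) (by simp [hl, hp])
    have hD' : ∀ {σ : V × Fin 2 → Option Bool}, ρ (i, j) ≠ some false → σ (i, j) = some true →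
        (∀ p ≠ (i, j), σ p = ρ p) → ∀ l ∈ D, σ l.1 = some (!l.2) := by
      rintro σ hv hσ hσρ ⟨p, b⟩ hl
      by_cases hp : p = (i, j)
      · subst hp
        cases b with
        | true => exact absurd (hρ ((i, j), true) (by simp [hl])) hv
        | false => exact hσ
      · rw [hσρ p hp]
        exact hρ (p, b) (by simp [hl, hp])
    have hupd : ∀ b, ∀ p ≠ (i, j), Function.update ρ (i, j) (some b) p = ρ p :=
      fun b p hp => Function.update_of_ne hp _ _
    cases hv : ρ (i, j) with
    | some b =>
      cases b with
      | false => exact ihC (hC' (by simp [hv]) hv fun _ _ => rfl) (by omega)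
      | true => exact ihD (hD' (by simp [hv]) hv fun _ _ => rfl) (by omega)
    | none =>
      have hC'' := hC' (by simp [hv]) (Function.update_self (i, j) (some false) ρ) (hupd false)
      have hD'' := hD' (by simp [hv]) (Function.update_self (i, j) (some true) ρ) (hupd true)
      cases ho : ρ (i, 1 - j) with
      | none =>
        have hs0 := hC.pos
        have ht0 := hD.pos
        -- Both subderivations are nonempty, so the total size is at least 3, which excludes `e =
        -- 0`.
        obtain ⟨e, rfl⟩ : ∃ e', e = e' + 1 :=
          ⟨e - 1, by rcases e with _ | e <;> simp at hs ⊢; omega⟩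
        rw [pow_succ] at hs
        rw [add_right_comm, add_assoc]
        rcases le_total s t with hst | hst
        · have := ihC hC'' (e := e) (by omega)
          rwa [halfSet_update_of_none ho hv, parities_update_of_none ho _ hv] at this
        · have := ihD hD'' (e := e) (by omega)
          rwa [halfSet_update_of_none ho hv, parities_update_of_none ho _ hv] at this
      | some a =>
        have hpar : parities ρ i = none := by
          fin_cases j <;> simp at ho hv <;> simp [parities, ho, hv]
        rw [← halfSet_update_of_some ho hv false, ← add_assoc]
        -- The queried parity `b` and the known bit `a` force the value `xor b a` of the pivot.
        refine Or.inr ⟨i, fun b => ?_⟩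
        simp only [fill_update_of_none hpar]
        rw [← parities_update_of_some (j := j) ho b]
        have hhalf : ∀ b, (halfSet (Function.update ρ (i, j) (some false))).card =
            (halfSet (Function.update ρ (i, j) (some b))).card := by
          intro b
          have h1 := halfSet_update_of_some ho hv b
          have h2 := halfSet_update_of_some ho hv false
          omega
        rw [hhalf (xor b a)]
        cases xor b a with
        | false => exact ihC hC'' (by omega)
        | true => exact ihD hD'' (by omega)

end TreeLike

theorem certClause_falsifies_agreeOn {f : BoolFun} {x y : f.Var → Bool}
    (h : Falsifies y (certClause f x)) : AgreeOn (f.cert x) x y := by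
  intro v hv
  have := h (v, !x v) (mem_certClause.2 ⟨hv, rfl⟩)
  revert this
  cases x v <;> cases y v <;> simp

theorem Unambiguous.two_pow_depth_le {f : BoolFun} (hf : Unambiguous f) {s : ℕ}
    (h : TreeResDerivation (partitionCNF (HittingRes.comp f xorFun)) ∅ s) : 2 ^ f.depth ≤ s := by
  have hd := decides_fill_parities (f := f.eval) (e := Nat.log 2 s) (ρ := fun _ => none)
    (fun C hC => by
      obtain ⟨x, rfl⟩ := mem_partitionCNF.1 hC
      exact ⟨(HittingRes.comp f xorFun).eval x, fun y hy =>
        (hf.comp unambiguous_xorFun).eval_eq _ _ (certClause_falsifies_agreeOn hy)⟩)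
    h (by simp) (Nat.lt_pow_succ_log_self one_lt_two s)
  have hp : parities (fun _ : f.Var × Fin 2 => none) = fun _ => none := rfl
  have hh : halfSet (fun _ : f.Var × Fin 2 => none) = ∅ := by simp [halfSet]
  rw [hp, hh, Finset.card_empty, add_zero] at hd
  exact (Nat.pow_le_pow_right two_pos (queryDepth_le hd)).trans
    (Nat.pow_log_le_self 2 h.pos.ne')

/-! ### Querying with bounded memory -/

/-- `W S x` says that the goal can be reached when the memory consists of the values of `x` on `S`:
one may query a variable as long as the memory holds less than `w` bits, and one may forget. -/
structure IsGame {V : Type} [DecidableEq V] (w : ℕ) (W : Finset V → (V → Bool) → Prop) : Prop where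
  query : ∀ S x v, S.card < w → (∀ y, AgreeOn S x y → W (insert v S) y) → W S x
  forget : ∀ S T x, S ⊆ T → W S x → W T x

theorem AgreeOn.mono {V : Type} {S T : Finset V} {x y : V → Bool} (h : AgreeOn T x y)
    (hST : S ⊆ T) : AgreeOn S x y := fun v hv => h v (hST hv)

theorem AgreeOn.trans {V : Type} {S : Finset V} {x y z : V → Bool} (h : AgreeOn S x y)
    (h' : AgreeOn S y z) : AgreeOn S x z := fun v hv => (h v hv).trans (h' v hv)

theorem IsGame.query_all {V : Type} [DecidableEq V] {w : ℕ} {W : Finset V → (V → Bool) → Prop}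
    (hW : IsGame w W) (T : Finset V) {S : Finset V} {x : V → Bool} (hc : S.card + T.card ≤ w)
    (h : ∀ y, AgreeOn S x y → W (S ∪ T) y) : W S x := by
  induction T using Finset.induction_on generalizing S x with
  | empty => simpa using h x fun _ _ => rfl
  | insert v T hv ih =>
    rw [Finset.card_insert_of_notMem hv] at hc
    refine hW.query S x v (by omega) fun y hy => ih ?_ fun z hz => ?_
    · have := Finset.card_insert_le v S
      omega
    · have := h z (hy.trans (hz.mono (Finset.subset_insert v S)))
      rwa [Finset.union_insert, ← Finset.insert_union] at this

/-- With `M` bits of memory one can find the designated certificate of the input of `f`. -/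
def WithMemory (f : BoolFun) (M : ℕ) : Prop :=
  ∀ (V : Type) [DecidableEq V] (e : f.Var ↪ V) (w : ℕ) (W : Finset V → (V → Bool) → Prop),
    IsGame w W → ∀ S x, S.card + M ≤ w →
      (∀ y, AgreeOn S x y → W (S ∪ (f.cert fun v => y (e v)).map e) y) → W S x

theorem withMemory_card (f : BoolFun) : WithMemory f (Fintype.card f.Var) := by
  intro V _ e w W hW S x hc h
  refine hW.query_all (Finset.univ.map e) (by simpa using hc) fun y hy => ?_
  exact hW.forget _ _ _ (Finset.union_subset_union_right (Finset.map_subset_map.2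
    (Finset.subset_univ _))) (h y hy)

theorem WithMemory.mono {f : BoolFun} {M M' : ℕ} (h : WithMemory f M) (hM : M ≤ M') :
    WithMemory f M' :=
  fun V _ e w W hW S x hc => h V e w W hW S x (by omega)

theorem card_comp_cert_le {f g : BoolFun} {U : ℕ} (hU : ∀ x, (g.cert x).card ≤ U)
    (x : (comp f g).Var → Bool) :
    ((comp f g).cert x).card ≤
      (f.cert fun i => g.eval fun j => x (i, j)).card * U := by
  classical
  have hsub : (comp f g).cert x ⊆ (f.cert fun i => g.eval fun j => x (i, j)).biUnion
      fun i => (g.cert fun j => x (i, j)).image fun j => (i, j) := by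
    intro p hp
    obtain ⟨h1, h2⟩ := mem_comp_cert.1 hp
    exact Finset.mem_biUnion.2 ⟨p.1, h1, Finset.mem_image.2 ⟨p.2, h2, rfl⟩⟩
  exact (Finset.card_le_card hsub).trans (Finset.card_biUnion_le_card_mul _ _ _ fun i _ =>
    Finset.card_image_le.trans (hU _))

/-! ### Compositions with bounded memory -/

section Memory

variable {f g : BoolFun} {V : Type}

/-- The certificate of the `i`-th copy of `g`. -/
def blockCert (e : (comp f g).Var ↪ V) (y : V → Bool) (i : f.Var) : Finset V :=
  (g.cert fun j => y (e (i, j))).map ⟨fun j => e (i, j), fun j j' h => by simpa using h⟩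

/-- The value of the `i`-th copy of `g`. -/
def blockVal (e : (comp f g).Var ↪ V) (y : V → Bool) (i : f.Var) : Bool :=
  g.eval fun j => y (e (i, j))

theorem blockVal_congr (hg : Unambiguous g) {e : (comp f g).Var ↪ V} {y z : V → Bool} {i : f.Var}
    (h : AgreeOn (blockCert e y i) y z) : blockVal e z i = blockVal e y i :=
  hg.eval_eq _ _ fun j hj => h _ (Finset.mem_map.2 ⟨j, hj, rfl⟩)

theorem blockCert_congr (hg : Unambiguous g) {e : (comp f g).Var ↪ V} {y z : V → Bool} {i : f.Var}
    (h : AgreeOn (blockCert e y i) y z) : blockCert e z i = blockCert e y i := by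
  unfold blockCert
  rw [hg.cert_eq (fun j => y (e (i, j))) (fun j => z (e (i, j)))
    fun j hj => h _ (Finset.mem_map.2 ⟨j, hj, rfl⟩)]

variable [DecidableEq V]

theorem comp_cert_map (e : (comp f g).Var ↪ V) (y : V → Bool) :
    ((comp f g).cert fun p => y (e p)).map e = (f.cert (blockVal e y)).biUnion (blockCert e y) := by
  ext v
  rw [Finset.mem_map, Finset.mem_biUnion]
  constructor
  · rintro ⟨⟨i, j⟩, h, rfl⟩
    obtain ⟨h1, h2⟩ := mem_comp_cert.1 h
    exact ⟨i, h1, Finset.mem_map.2 ⟨j, h2, rfl⟩⟩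
  · rintro ⟨i, h1, h⟩
    obtain ⟨j, h2, rfl⟩ := Finset.mem_map.1 h
    exact ⟨(i, j), mem_comp_cert.2 ⟨h1, h2⟩, rfl⟩

/-- The strategy for `f` is simulated with each remembered bit stored as the certificate of its
block, at most `U` bits; `Mg` further bits serve to evaluate the block being queried. -/
theorem WithMemory.comp {Mf Mg U : ℕ} (hf : Unambiguous f) (hg : Unambiguous g)
    (hMf : WithMemory f Mf) (hMg : WithMemory g Mg) (hU : ∀ x, (g.cert x).card ≤ U) :
    WithMemory (comp f g) (Mf * U + Mg) := by
  intro V _ e w W hW S x hc h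
  have hblock : ∀ y i, (blockCert e y i).card ≤ U := fun y i => by
    rw [blockCert, Finset.card_map]
    exact hU _
  -- Quantifying over all `y` with these block values turns the game on `V` into one on the
  -- variables of `f`. By unambiguity, stored block certificates do not change while other blocks
  -- are evaluated.
  let W' : Finset f.Var → (f.Var → Bool) → Prop := fun S' z => ∀ y, AgreeOn S x y →
    (∀ i ∈ S', blockVal e y i = z i) → W (S ∪ S'.biUnion (blockCert e y)) y
  have hW' : IsGame Mf W' := by
    constructor
    · intro S' z i hS' hq y hy hyz
      refine hMg V ⟨fun j => e (i, j), fun j j' h => by simpa using h⟩ w W hW _ y ?_ fun y' hy' => ?_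
      · have h1 := Finset.card_union_le S (S'.biUnion (blockCert e y))
        have h2 := Finset.card_biUnion_le_card_mul S' (blockCert e y) U fun i _ => hblock y i
        have h3 : S'.card * U ≤ Mf * U := Nat.mul_le_mul_right U hS'.le
        omega
      · have hag : ∀ i' ∈ S', AgreeOn (blockCert e y i') y y' := fun i' hi' => hy'.mono
          ((Finset.subset_biUnion_of_mem (blockCert e y) hi').trans Finset.subset_union_right)
        have key := hq (blockVal e y') (fun i' hi' => by
          rw [blockVal_congr hg (hag i' hi'), hyz i' hi']) y'
          (hy.trans (hy'.mono Finset.subset_union_left)) fun _ _ => rfl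
        rw [Finset.biUnion_insert, Finset.biUnion_congr rfl fun i' hi' =>
          blockCert_congr hg (hag i' hi')] at key
        rw [Finset.union_comm (blockCert e y' i), ← Finset.union_assoc] at key
        exact key
    · intro S' T' z hST hS y hy hyz
      exact hW.forget _ _ _ (Finset.union_subset_union_right
        (Finset.biUnion_subset_biUnion_of_subset_left _ hST))
        (hS y hy fun i hi => hyz i (hST hi))
  have key := hMf f.Var (Function.Embedding.refl _) Mf W' hW' ∅ (blockVal e x) (by simp)
    fun z _ y hy hyz => ?_
  · simpa using key x (fun _ _ => rfl) (by simp)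
  · simp only [Function.Embedding.refl_apply, Finset.empty_union, Finset.map_refl] at hyz ⊢
    have := h y hy
    rwa [comp_cert_map, hf.cert_eq z _ fun i hi => (hyz i hi).symm] at this

/-- The copies are evaluated in order up to the first 0, so all certificates stored during an
evaluation belong to copies of value 1. Hence `U` need only bound these, which is what makes cheat
sheets profitable here. -/
theorem WithMemory.comp_andFun {n Mg U : ℕ} (hg : Unambiguous g)
    (hMg : WithMemory g Mg) (hU : ∀ x, g.eval x = true → (g.cert x).card ≤ U) :
    WithMemory (HittingRes.comp (andFun n) g) (n * U + Mg) := by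
  intro V _ e w W hW S x hc h
  have step : ∀ r j : ℕ, j + r = n → ∀ y, AgreeOn S x y →
      (∀ i : Fin n, (i : ℕ) < j → blockVal e y i = true) →
      W (S ∪ (Finset.univ.filter fun i : Fin n => (i : ℕ) < j).biUnion (blockCert e y)) y := by
    intro r
    induction r with
    | zero =>
      intro j hj y hy _
      have := h y hy
      rw [comp_cert_map] at this
      refine hW.forget _ _ _ (Finset.union_subset_union_right
        (Finset.biUnion_subset_biUnion_of_subset_left _ fun i _ => ?_)) this
      simpa using by omega
    | succ r ih =>
      intro j hj y hy hyj
      let i : Fin n := ⟨j, by omega⟩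
      refine hMg V ⟨fun j => e (i, j), fun j j' h => by simpa using h⟩ w W hW _ y ?_ fun y' hy' => ?_
      · have h1 := Finset.card_union_le S
          ((Finset.univ.filter fun i : Fin n => (i : ℕ) < j).biUnion (blockCert e y))
        have h2 := Finset.card_biUnion_le_card_mul
          (Finset.univ.filter fun i : Fin n => (i : ℕ) < j) (blockCert e y) U fun i hi => by
            rw [blockCert, Finset.card_map]
            exact hU _ (hyj i (Finset.mem_filter.1 hi).2)
        have h3 : (Finset.univ.filter fun i : Fin n => (i : ℕ) < j).card * U ≤ n * U :=
          Nat.mul_le_mul_right U ((Finset.card_le_univ _).trans (by simp))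
        omega
      · have hag : ∀ i' : Fin n, (i' : ℕ) < j → AgreeOn (blockCert e y i') y y' :=
          fun i' hi' => hy'.mono ((Finset.subset_biUnion_of_mem (blockCert e y)
            (Finset.mem_filter.2 ⟨Finset.mem_univ i', hi'⟩)).trans Finset.subset_union_right)
        have hy'' := hy.trans (hy'.mono Finset.subset_union_left)
        have hval : ∀ i' : Fin n, (i' : ℕ) < j → blockVal e y' i' = true := fun i' hi' => by
          rw [blockVal_congr hg (hag i' hi'), hyj i' hi']
        have hmem : (Finset.univ.filter fun i : Fin n => (i : ℕ) < j + 1).biUnion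
            (blockCert e y') ⊆ (Finset.univ.filter fun i : Fin n => (i : ℕ) < j).biUnion
              (blockCert e y) ∪ blockCert e y' i := by
          intro v hv
          obtain ⟨i', hi', hv⟩ := Finset.mem_biUnion.1 hv
          rw [Finset.mem_filter] at hi'
          rcases Nat.lt_succ_iff_lt_or_eq.1 hi'.2 with hlt | heq
          · rw [blockCert_congr hg (hag i' hlt)] at hv
            exact Finset.mem_union_left _ (Finset.mem_biUnion.2
              ⟨i', Finset.mem_filter.2 ⟨Finset.mem_univ _, hlt⟩, hv⟩)
          · rw [show i' = i from Fin.ext heq] at hv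
            exact Finset.mem_union_right _ hv
        refine hW.forget (S ∪ (Finset.univ.filter fun i : Fin n =>
          (i : ℕ) < j + 1).biUnion (blockCert e y')) _ _ ?_ ?_
        · rw [Finset.union_assoc]
          exact Finset.union_subset_union_right hmem
        cases hv : blockVal e y' i with
        | true =>
          refine ih (j + 1) (by omega) y' hy'' fun i' hi' => ?_
          rcases Nat.lt_succ_iff_lt_or_eq.1 hi' with hlt | heq
          · exact hval i' hlt
          · rw [show i' = i from Fin.ext heq, hv]
        | false =>
          have := h y' hy''
          rw [comp_cert_map] at this
          refine hW.forget _ _ _ (Finset.union_subset_union_right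
            (Finset.biUnion_subset_biUnion_of_subset_left _ fun i' hi' => ?_)) this
          simp only [Finset.mem_filter, Finset.mem_univ, true_and] at hi' ⊢
          by_contra hcon
          have := hi' i (Fin.lt_def.2 (by simp only [i]; omega))
          rw [hv] at this
          exact Bool.false_ne_true this
  simpa using step n 0 (by omega) x (fun _ _ => rfl) (by simp)

end Memory

/-! ### Cheat sheets with bounded memory -/

section CheatSheet

variable {f : BoolFun}

/-- The Boolean function on `c` variables that inspects all of them. -/
abbrev readAll (c : ℕ) : BoolFun where
  Var := Fin c
  eval _ := true
  cert _ := Finset.univ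

theorem unambiguous_readAll (c : ℕ) : Unambiguous (readAll c) :=
  ⟨fun _ _ _ => rfl, fun _ _ _ => rfl⟩

theorem card_pointedSet_le (f : BoolFun)
    (Y : Fin (certComplexity f.eval) → Fin (pointerBits f) → Bool) :
    (pointedSet f Y).card ≤ certComplexity f.eval := by
  classical
  have hsub : pointedSet f Y ⊆ Finset.univ.biUnion fun s => (decodePointer f (Y s)).toFinset := by
    intro v hv
    simp only [pointedSet, Finset.mem_filter, Finset.mem_univ, true_and] at hv
    obtain ⟨s, hs⟩ := hv
    exact Finset.mem_biUnion.2 ⟨s, Finset.mem_univ s, by simp [hs]⟩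
  refine (Finset.card_le_card hsub).trans ((Finset.card_biUnion_le_card_mul _ _ 1
    fun s _ => ?_).trans (by simp))
  cases decodePointer f (Y s) <;> simp

/-- The contents of the cell at the address of `x`. -/
noncomputable def cellVars (x : CheatVar f → Bool) : Finset (CheatVar f) :=
  Finset.univ.map ⟨fun p => Sum.inr (address x, p), fun p q h => by simpa using h⟩

/-- The positions in the copies of `f` to which the cell at the address of `x` points. -/
noncomputable def positionVars (x : CheatVar f → Bool) : Finset (CheatVar f) :=
  (Finset.univ.sigma fun i => cellPositions x i).map
    ⟨fun p => Sum.inl (p.1, p.2), by rintro ⟨i, v⟩ ⟨j, w⟩ h; simpa using h⟩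

/-- The designated certificates of the copies of `f`. -/
noncomputable def copyCertVars (x : CheatVar f → Bool) : Finset (CheatVar f) :=
  (Finset.univ.sigma fun i => f.cert (copyInput x i)).map
    ⟨fun p => Sum.inl (p.1, p.2), by rintro ⟨i, v⟩ ⟨j, w⟩ h; simpa using h⟩

theorem card_cellVars (x : CheatVar f → Bool) :
    (cellVars x).card = copies f * (certComplexity f.eval * pointerBits f) := by
  simp [cellVars]

theorem card_positionVars_le (x : CheatVar f → Bool) :
    (positionVars x).card ≤ copies f * certComplexity f.eval := by
  rw [positionVars, Finset.card_map, Finset.card_sigma]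
  refine (Finset.sum_le_sum fun i _ => card_pointedSet_le f _).trans ?_
  simp

theorem card_copyCertVars_le {U : ℕ} (hU : ∀ x, (f.cert x).card ≤ U) (x : CheatVar f → Bool) :
    (copyCertVars x).card ≤ copies f * U := by
  rw [copyCertVars, Finset.card_map, Finset.card_sigma]
  refine (Finset.sum_le_sum fun i _ => hU _).trans ?_
  simp

theorem mem_cellVars {x : CheatVar f → Bool} {l : Fin (copies f) → Bool}
    {p : Fin (copies f) × Fin (certComplexity f.eval) × Fin (pointerBits f)} :
    (Sum.inr (l, p) : CheatVar f) ∈ cellVars x ↔ l = address x := by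
  rw [cellVars, Finset.mem_map]
  constructor
  · rintro ⟨q, -, hq⟩
    exact (Prod.mk.inj (Sum.inr_injective hq)).1.symm
  · rintro rfl
    exact ⟨p, Finset.mem_univ p, rfl⟩

theorem mem_positionVars {x : CheatVar f → Bool} {i : Fin (copies f)} {v : f.Var} :
    (Sum.inl (i, v) : CheatVar f) ∈ positionVars x ↔ v ∈ cellPositions x i := by
  rw [positionVars, Finset.mem_map]
  constructor
  · rintro ⟨⟨j, w⟩, hq, hqe⟩
    obtain ⟨rfl, rfl⟩ := Prod.mk.inj (Sum.inl_injective hqe)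
    exact (Finset.mem_sigma.1 hq).2
  · intro hv
    exact ⟨⟨i, v⟩, Finset.mem_sigma.2 ⟨Finset.mem_univ i, hv⟩, rfl⟩

theorem mem_copyCertVars {x : CheatVar f → Bool} {i : Fin (copies f)} {v : f.Var} :
    (Sum.inl (i, v) : CheatVar f) ∈ copyCertVars x ↔ v ∈ f.cert (copyInput x i) := by
  rw [copyCertVars, Finset.mem_map]
  constructor
  · rintro ⟨⟨j, w⟩, hq, hqe⟩
    obtain ⟨rfl, rfl⟩ := Prod.mk.inj (Sum.inl_injective hqe)
    exact (Finset.mem_sigma.1 hq).2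
  · intro hv
    exact ⟨⟨i, v⟩, Finset.mem_sigma.2 ⟨Finset.mem_univ i, hv⟩, rfl⟩

theorem cheatSheet_cert_of_true [DecidableEq (CheatVar f)] {x : CheatVar f → Bool}
    (hx : cheatEval f x = true) : (cheatSheet f).cert x ⊆ cellVars x ∪ positionVars x := by
  rintro (⟨i, v⟩ | ⟨l, p⟩) h
  · rw [mem_cheatSheet_cert_inl] at h
    rcases h with h | ⟨h, -⟩
    · exact Finset.mem_union_right _ (mem_positionVars.2 h)
    · exact absurd (hx.symm.trans h) (by simp)
  · exact Finset.mem_union_left _ (mem_cellVars.2 (mem_cheatSheet_cert_inr.1 h))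

theorem cheatSheet_cert_subset [DecidableEq (CheatVar f)] (x : CheatVar f → Bool) :
    (cheatSheet f).cert x ⊆ copyCertVars x ∪ (cellVars x ∪ positionVars x) := by
  rintro (⟨i, v⟩ | ⟨l, p⟩) h
  · rw [mem_cheatSheet_cert_inl] at h
    rcases h with h | ⟨-, h⟩
    · exact Finset.mem_union_right _ (Finset.mem_union_right _ (mem_positionVars.2 h))
    · exact Finset.mem_union_left _ (mem_copyCertVars.2 h)
  · exact Finset.mem_union_right _
      (Finset.mem_union_left _ (mem_cellVars.2 (mem_cheatSheet_cert_inr.1 h)))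

/-- The number of variables that a cell has or points to. -/
noncomputable def sheetSize (f : BoolFun) : ℕ :=
  copies f * (certComplexity f.eval * pointerBits f) + copies f * certComplexity f.eval

theorem card_cheatSheet_cert_of_true_le {x : CheatVar f → Bool} (hx : cheatEval f x = true) :
    ((cheatSheet f).cert x).card ≤ sheetSize f := by
  classical
  refine (Finset.card_le_card (cheatSheet_cert_of_true hx)).trans
    ((Finset.card_union_le _ _).trans ?_)
  exact Nat.add_le_add (card_cellVars x).le (card_positionVars_le x)

theorem card_cheatSheet_cert_le {U : ℕ} (hU : ∀ x, (f.cert x).card ≤ U) (x : CheatVar f → Bool) :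
    ((cheatSheet f).cert x).card ≤ copies f * U + sheetSize f := by
  classical
  refine (Finset.card_le_card (cheatSheet_cert_subset x)).trans
    ((Finset.card_union_le _ _).trans (Nat.add_le_add (card_copyCertVars_le hU x)
    ((Finset.card_union_le _ _).trans ?_)))
  exact Nat.add_le_add (card_cellVars x).le (card_positionVars_le x)

/-- Find the certificates of all copies, which give the address, then read its cell, then the
positions it points to. Surplus bits, such as the copies' certificates on a 1-input, are forgotten
at the end. -/
theorem WithMemory.cheatSheet {M U : ℕ} (hf : Unambiguous f) (hM : WithMemory f M)
    (hU : ∀ x, (f.cert x).card ≤ U) :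
    WithMemory (cheatSheet f) (copies f * U + M + sheetSize f) := by
  intro V _ e w W hW S x hc h
  have hread := WithMemory.comp (unambiguous_readAll (copies f)) hf (withMemory_card _) hM hU
  rw [Fintype.card_fin] at hread
  let e₁ : (HittingRes.comp (readAll (copies f)) f).Var ↪ V :=
    ⟨fun p => e (Sum.inl p), fun p q h => by simpa using h⟩
  have hcopy : ∀ y : V → Bool, ((HittingRes.comp (readAll (copies f)) f).cert fun p => y (e₁ p)).map e₁
      = (copyCertVars fun v => y (e v)).map e := by
    intro y
    ext v
    rw [Finset.mem_map, Finset.mem_map]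
    constructor
    · rintro ⟨⟨i, j⟩, hp, rfl⟩
      exact ⟨_, mem_copyCertVars.2 (mem_comp_cert.1 hp).2, rfl⟩
    · rintro ⟨⟨i, j⟩ | p, hp, rfl⟩
      · exact ⟨(i, j), mem_comp_cert.2 ⟨Finset.mem_univ _, mem_copyCertVars.1 hp⟩, rfl⟩
      · simp [copyCertVars] at hp
  unfold sheetSize at hc
  refine hread V e₁ w W hW S x (by omega) fun y hy => ?_
  rw [hcopy]
  set S₁ := S ∪ (copyCertVars fun v => y (e v)).map e with hS₁
  have hS₁c : S₁.card ≤ S.card + copies f * U := by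
    refine (Finset.card_union_le _ _).trans (Nat.add_le_add_left ?_ _)
    rw [Finset.card_map]
    exact card_copyCertVars_le hU _
  have haddr : ∀ z, AgreeOn S₁ y z →
      (address fun v => z (e v)) = address (f := f) fun v => y (e v) := fun z hz => funext fun i =>
    hf.eval_eq _ _ fun v hv => hz _ (Finset.mem_union_right _
      (Finset.mem_map_of_mem e (mem_copyCertVars.2 hv)))
  have hcell := card_cellVars fun v => y (e v)
  refine hW.query_all ((cellVars fun v => y (e v)).map e) (by rw [Finset.card_map]; omega)
    fun y₂ hy₂ => ?_
  have hcell₂ : cellVars (fun v => y₂ (e v)) = cellVars (f := f) fun v => y (e v) := by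
    unfold cellVars
    simp only [haddr y₂ hy₂]
  have hpos := card_positionVars_le fun v => y₂ (e v)
  refine hW.query_all ((positionVars fun v => y₂ (e v)).map e) ?_ fun y₃ hy₃ => ?_
  · have := Finset.card_union_le S₁ ((cellVars fun v => y (e v)).map e)
    rw [Finset.card_map] at this ⊢
    omega
  · have hy₁₃ : AgreeOn S₁ y y₃ := hy₂.trans (hy₃.mono Finset.subset_union_left)
    have hpos₃ : positionVars (fun v => y₃ (e v)) = positionVars (f := f) fun v => y₂ (e v) := by
      unfold positionVars
      congr 2
      funext i
      refine cellPositions_congr ((haddr y₃ hy₁₃).trans (haddr y₂ hy₂).symm) (fun p => ?_) i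
      refine hy₃ _ (Finset.mem_union_right _ (Finset.mem_map_of_mem e ?_))
      rw [← hcell₂]
      exact mem_cellVars.2 rfl
    have hcell₃ : cellVars (fun v => y₃ (e v)) = cellVars (f := f) fun v => y (e v) := by
      unfold cellVars
      simp only [haddr y₃ hy₁₃]
    have hcopy₃ : copyCertVars (fun v => y₃ (e v)) = copyCertVars (f := f) fun v => y (e v) := by
      unfold copyCertVars
      congr 2
      funext i
      exact hf.cert_eq _ _ fun v hv => hy₁₃ _ (Finset.mem_union_right _
        (Finset.mem_map_of_mem e (mem_copyCertVars.2 hv)))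
    refine hW.forget _ _ _ ?_ (h y₃ (hy.trans (hy₁₃.mono Finset.subset_union_left)))
    classical
    refine (Finset.union_subset_union_right
      (Finset.map_subset_map.2 (cheatSheet_cert_subset _))).trans ?_
    rw [hcell₃, hpos₃, hcopy₃, Finset.map_union, Finset.map_union, hS₁]
    simp only [Finset.union_assoc]
    exact subset_rfl

end CheatSheet

/-! ### Resolution refutations of bounded width -/

section Width

variable {V : Type}

theorem card_le_of_literals {S : Finset V} {x : V → Bool} {C : Clause V}
    (h : ∀ l ∈ C, l.1 ∈ S ∧ l.2 = !x l.1) : C.card ≤ S.card := by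
  refine Finset.card_le_card_of_injOn Prod.fst (fun l hl => (h l hl).1) ?_
  intro l hl l' hl' hll
  exact Prod.ext hll (by rw [(h l hl).2, (h l' hl').2, hll])

variable [DecidableEq V]

/-- Take a longest duplicate-free derivation of width at most `w`; it exists as there are finitely
many clauses. -/
theorem exists_closed_derivation [Fintype V] (F : CNF V) (w : ℕ) :
    ∃ π : List (Clause V), ResDerivation F π ∧ π.Nodup ∧ (∀ C ∈ π, C.card ≤ w) ∧
      (∀ C ∈ F, C.card ≤ w → C ∈ π) ∧
      ∀ C ∈ π, ∀ D ∈ π, ∀ R, IsResolvent C D R → R.card ≤ w → R ∈ π := by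
  let P : Set ℕ := {n | ∃ π : List (Clause V), π.length = n ∧ ResDerivation F π ∧ π.Nodup ∧
    ∀ C ∈ π, C.card ≤ w}
  have hne : P.Nonempty := ⟨0, [], rfl, .nil, List.nodup_nil, by simp⟩
  have hbdd : BddAbove P := by
    refine ⟨Fintype.card (Clause V), ?_⟩
    rintro n ⟨π, rfl, -, hn, -⟩
    exact hn.length_le_card
  obtain ⟨π, hl, hd, hn, hw⟩ := Nat.sSup_mem hne hbdd
  have hmax : ∀ C, ResDerivation F (C :: π) → C.card ≤ w → C ∈ π := by
    intro C hC hCw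
    by_contra hmem
    have : (C :: π).length ≤ sSup P := le_csSup hbdd ⟨_, rfl, hC, List.nodup_cons.2 ⟨hmem, hn⟩, by
      simpa using ⟨hCw, hw⟩⟩
    rw [List.length_cons] at this
    omega
  exact ⟨π, hd, hn, hw, fun C hC hCw => hmax C (.initial hd hC) hCw,
    fun C hC D hD R hR hRw => hmax R (.resolve hd hC hD hR) hRw⟩

/-- A memory state is winning if it falsifies a derived clause. Both answers to a query of `v` give
such clauses: either one of them avoids `v` and is already falsified, or their resolvent on `v` is.
The resolvent mentions only variables in memory, so it is narrow. -/
theorem isGame_of_closed {π : List (Clause V)} {w : ℕ}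
    (hπ : ∀ C ∈ π, ∀ D ∈ π, ∀ R, IsResolvent C D R → R.card ≤ w → R ∈ π) :
    IsGame w fun S x => ∃ C ∈ π, ∀ l ∈ C, l.1 ∈ S ∧ l.2 = !x l.1 := by
  constructor
  · intro S x v hS h
    by_cases hv : v ∈ S
    · simpa [Finset.insert_eq_of_mem hv] using h x fun _ _ => rfl
    have key : ∀ b, ∃ C ∈ π, ∀ l ∈ C, l = (v, !b) ∨ (l.1 ∈ S ∧ l.2 = !x l.1) := by
      intro b
      have hag : ∀ u ∈ S, Function.update x v b u = x u := fun u hu =>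
        Function.update_of_ne (ne_of_mem_of_not_mem hu hv) _ _
      obtain ⟨C, hC, hl⟩ := h (Function.update x v b) fun u hu => (hag u hu).symm
      refine ⟨C, hC, fun l hlC => ?_⟩
      obtain ⟨h1, h2⟩ := hl l hlC
      rcases Finset.mem_insert.1 h1 with h1 | h1
      · left
        rw [h1, Function.update_self] at h2
        exact Prod.ext h1 h2
      · right
        exact ⟨h1, by rw [h2, hag _ h1]⟩
    obtain ⟨C, hC, hCl⟩ := key false
    obtain ⟨D, hD, hDl⟩ := key true
    simp only [Bool.not_false, Bool.not_true] at hCl hDl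
    by_cases hvC : (v, true) ∈ C
    · by_cases hvD : (v, false) ∈ D
      · have hR : ∀ l ∈ C.erase (v, true) ∪ D.erase (v, false), l.1 ∈ S ∧ l.2 = !x l.1 := by
          intro l hl
          rcases Finset.mem_union.1 hl with hl | hl
          · obtain ⟨h1, h2⟩ := Finset.mem_erase.1 hl
            exact (hCl l h2).resolve_left h1
          · obtain ⟨h1, h2⟩ := Finset.mem_erase.1 hl
            exact (hDl l h2).resolve_left h1
        exact ⟨_, hπ C hC D hD _ ⟨v, hvC, hvD, rfl⟩ ((card_le_of_literals hR).trans hS.le), hR⟩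
      · exact ⟨D, hD, fun l hl => (hDl l hl).resolve_left fun h => hvD (h ▸ hl)⟩
    · exact ⟨C, hC, fun l hl => (hCl l hl).resolve_left fun h => hvC (h ▸ hl)⟩
  · rintro S T x hST ⟨C, hC, hl⟩
    exact ⟨C, hC, fun l hlC => ⟨hST (hl l hlC).1, (hl l hlC).2⟩⟩

/-- A set of at most `M` elements can be listed as an `M`-tuple padded by `none`. -/
theorem card_filter_card_le {α : Type*} [Fintype α] [DecidableEq α] (M : ℕ) :
    (Finset.univ.filter fun C : Finset α => C.card ≤ M).card ≤ (Fintype.card α + 1) ^ M := by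
  have h : (Finset.univ.filter fun C : Finset α => C.card ≤ M) ⊆
      (Finset.univ : Finset (Fin M → Option α)).image
        fun g => Finset.univ.filter fun a => ∃ i, g i = some a := by
    intro C hC
    replace hC := (Finset.mem_filter.1 hC).2
    refine Finset.mem_image.2 ⟨fun i => if h : (i : ℕ) < C.card then
      some (C.equivFin.symm ⟨i, h⟩ : α) else none, Finset.mem_univ _, ?_⟩
    ext a
    simp only [Finset.mem_filter, Finset.mem_univ, true_and]
    constructor
    · rintro ⟨i, hi⟩
      split_ifs at hi with h
      · rw [← Option.some_injective _ hi]
        exact (C.equivFin.symm _).2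
    · intro ha
      exact ⟨⟨C.equivFin ⟨a, ha⟩, (C.equivFin ⟨a, ha⟩).2.trans_le hC⟩, by simp⟩
  refine (Finset.card_le_card h).trans (Finset.card_image_le.trans ?_)
  simp

end Width

theorem card_certClause (f : BoolFun) (x : f.Var → Bool) :
    (certClause f x).card = (f.cert x).card :=
  Finset.card_image_of_injective _ fun _ _ h => (Prod.mk.inj h).1

theorem card_partitionCNF_le {f : BoolFun} {M : ℕ} (hM : ∀ x, (f.cert x).card ≤ M) :
    (partitionCNF f).card ≤ (2 * Fintype.card f.Var + 1) ^ M := by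
  have h := card_filter_card_le (α := Literal f.Var) M
  rw [Fintype.card_prod, Fintype.card_bool, mul_comm] at h
  refine (Finset.card_le_card fun C hC => ?_).trans h
  obtain ⟨x, rfl⟩ := mem_partitionCNF.1 hC
  exact Finset.mem_filter.2 ⟨Finset.mem_univ _, (card_certClause f x).trans_le (hM x)⟩

theorem exists_refutation {f : BoolFun} {M : ℕ} (hM : ∀ x, (f.cert x).card ≤ M)
    (hf : WithMemory f M) : ∃ π, ResRefutation (partitionCNF f) π ∧
      π.length ≤ (2 * Fintype.card f.Var + 1) ^ M ∧ ∀ C ∈ π, C.card ≤ M := by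
  obtain ⟨π, hd, hn, hw, hi, hr⟩ := exists_closed_derivation (partitionCNF f) M
  refine ⟨π, ⟨hd, ?_⟩, ?_, hw⟩
  -- The game starts with empty memory, and a clause falsified by it is empty.
  · obtain ⟨C, hC, hl⟩ := hf f.Var (Function.Embedding.refl _) M _ (isGame_of_closed hr) ∅
      (fun _ => false) (by simp) fun y _ =>
      ⟨certClause f y, hi _ (mem_partitionCNF.2 ⟨y, rfl⟩) ((card_certClause f y).trans_le (hM y)),
        fun l hl => by simpa using mem_certClause.1 hl⟩
    have h0 : C = ∅ := Finset.eq_empty_of_forall_notMem fun l hlC =>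
      Finset.notMem_empty _ (hl l hlC).1
    rwa [h0] at hC
  · have h := card_filter_card_le (α := Literal f.Var) M
    rw [Fintype.card_prod, Fintype.card_bool, mul_comm] at h
    rw [← List.toFinset_card_of_nodup hn]
    exact (Finset.card_le_card fun C hC => Finset.mem_filter.2
      ⟨Finset.mem_univ _, hw C (List.mem_toFinset.1 hC)⟩).trans h

/-! ### Sizes of certificates -/

theorem certComplexity_le {V : Type} [Fintype V] [DecidableEq V] {f : (V → Bool) → Bool} {K : ℕ}
    (h : ∀ x, ∃ S : Finset V, S.card ≤ K ∧ IsCertificate f x S) : certComplexity f ≤ K := by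
  refine Finset.sup_le fun x _ => ?_
  obtain ⟨S, hS, hc⟩ := h x
  refine le_trans (Nat.sInf_le ?_) hS
  exact ⟨S, rfl, hc⟩

theorem certComplexity_le_card {V : Type} [Fintype V] [DecidableEq V] (f : (V → Bool) → Bool) :
    certComplexity f ≤ Fintype.card V :=
  certComplexity_le fun x => ⟨Finset.univ, le_rfl, fun y hy => by
    rw [show y = x from funext fun v => (hy v (Finset.mem_univ v)).symm]⟩

/-- All `0`-inputs of `f` have certificates of size at most `K`. -/
def FalseCertLE (f : BoolFun) (K : ℕ) : Prop :=
  ∀ x, f.eval x = false → ∃ S : Finset f.Var, S.card ≤ K ∧ IsCertificate f.eval x S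

theorem falseCertLE_andFun (n : ℕ) : FalseCertLE (andFun n) 1 := by
  intro x hx
  simp only [decide_eq_false_iff_not, not_forall] at hx
  obtain ⟨i, hi⟩ := hx
  refine ⟨{i}, le_rfl, fun y hy => ?_⟩
  have hyi := hy i (Finset.mem_singleton_self i)
  simp only [decide_eq_decide]
  exact iff_of_false (fun h => hi (hyi.trans (h i))) fun h => hi (h i)

theorem card_andFun_cert_le (n : ℕ) (x : Fin n → Bool) : ((andFun n).cert x).card ≤ n :=
  (Finset.card_le_univ _).trans (Fintype.card_fin n).le

theorem card_orFun_cert_le (n : ℕ) (x : Fin n → Bool) : ((orFun n).cert x).card ≤ n :=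
  (Finset.card_le_univ _).trans (Fintype.card_fin n).le

section Composition

variable {g : BoolFun} {n : ℕ}

theorem FalseCertLE.comp_andFun {K : ℕ} (hg : FalseCertLE g K) :
    FalseCertLE (comp (andFun n) g) K := by
  intro x hx
  simp only [decide_eq_false_iff_not, not_forall] at hx
  obtain ⟨i, hi⟩ := hx
  obtain ⟨S, hS, hc⟩ := hg _ (Bool.eq_false_iff.2 hi)
  refine ⟨S.map ⟨fun j => (i, j), Prod.mk_right_injective i⟩, by rwa [Finset.card_map],
    fun y hy => ?_⟩
  have hyi := hc (fun j => y (i, j)) fun j hj => hy _ (Finset.mem_map.2 ⟨j, hj, rfl⟩)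
  simp only [decide_eq_decide]
  exact iff_of_false (fun h => hi (hyi.symm.trans (h i))) fun h => hi (h i)

/-- One copy of value 1 certifies a 1-input; a 0-input needs 0-certificates of all `n` copies. These
need not be the designated ones, so the smaller `K₀` applies. -/
theorem certComplexity_comp_orFun_le {K K₀ : ℕ} (hg : ∀ x, (g.cert x).card ≤ K)
    (hu : Unambiguous g) (hg₀ : FalseCertLE g K₀) :
    certComplexity (comp (orFun n) g).eval ≤ max K (n * K₀) := by
  classical
  refine certComplexity_le fun x => ?_
  by_cases hx : ∃ i, (g.eval fun j => x (i, j)) = true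
  · obtain ⟨i, hi⟩ := hx
    refine ⟨(g.cert fun j => x (i, j)).map ⟨fun j => (i, j), Prod.mk_right_injective i⟩, ?_,
      fun y hy => ?_⟩
    · rw [Finset.card_map]
      exact (hg _).trans (le_max_left _ _)
    · have hyi := hu.eval_eq (fun j => x (i, j)) (fun j => y (i, j))
        fun j hj => hy _ (Finset.mem_map.2 ⟨j, hj, rfl⟩)
      simp only [decide_eq_decide]
      exact iff_of_true ⟨i, hyi.trans hi⟩ ⟨i, hi⟩
  · push Not at hx
    have hS := fun i => hg₀ (fun j => x (i, j)) (Bool.eq_false_iff.2 (hx i))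
    choose S hS hc using hS
    refine ⟨Finset.univ.biUnion fun i => (S i).map ⟨fun j => (i, j), Prod.mk_right_injective i⟩,
      ?_, fun y hy => ?_⟩
    · refine (Finset.card_biUnion_le_card_mul _ _ K₀ fun i _ => ?_).trans ?_
      · rw [Finset.card_map]
        exact hS i
      · simp
    · have hyi : ∀ i, (g.eval fun j => y (i, j)) = g.eval fun j => x (i, j) := fun i =>
        hc i _ fun j hj => hy _ (Finset.mem_biUnion.2
          ⟨i, Finset.mem_univ i, Finset.mem_map.2 ⟨j, hj, rfl⟩⟩)
      simp only [hyi]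

/-- Among the inspected copies at most one, the last, has value 0, so the large bound `U` is paid
only once. -/
theorem card_comp_andFun_cert_le {U₁ U : ℕ} (h₁ : ∀ x, g.eval x = true → (g.cert x).card ≤ U₁)
    (hU : ∀ x, (g.cert x).card ≤ U) (x : (comp (andFun n) g).Var → Bool) :
    ((comp (andFun n) g).cert x).card ≤ n * U₁ + U := by
  classical
  let val : Fin n → Bool := fun i => g.eval fun j => x (i, j)
  let block : Fin n → Finset (Fin n × g.Var) := fun i =>
    (g.cert fun j => x (i, j)).map ⟨fun j => (i, j), Prod.mk_right_injective i⟩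
  have hsub : (comp (andFun n) g).cert x ⊆
      (Finset.univ.filter fun i => val i = true).biUnion block ∪
        (((andFun n).cert val).filter fun i => val i = false).biUnion block := by
    rintro ⟨i, j⟩ h
    obtain ⟨h1, h2⟩ := mem_comp_cert.1 h
    have hb : (i, j) ∈ block i := Finset.mem_map.2 ⟨j, h2, rfl⟩
    cases hv : val i with
    | true => exact Finset.mem_union_left _ (Finset.mem_biUnion.2 ⟨i, by simp [hv], hb⟩)
    | false => exact Finset.mem_union_right _ (Finset.mem_biUnion.2
        ⟨i, Finset.mem_filter.2 ⟨h1, hv⟩, hb⟩)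
  refine (Finset.card_le_card hsub).trans ((Finset.card_union_le _ _).trans (Nat.add_le_add ?_ ?_))
  · refine (Finset.card_biUnion_le_card_mul _ _ U₁ fun i hi => ?_).trans
      (Nat.mul_le_mul_right _ ((Finset.card_le_univ _).trans (Fintype.card_fin n).le))
    rw [Finset.card_map]
    exact h₁ _ (Finset.mem_filter.1 hi).2
  · have hone : (((andFun n).cert val).filter fun i => val i = false).card ≤ 1 := by
      refine Finset.card_le_one.2 fun i hi j hj => ?_
      simp only [Finset.mem_filter, Finset.mem_univ, true_and] at hi hj
      rcases lt_trichotomy i j with h | h | h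
      · exact absurd ((hj.1 i h).symm.trans hi.2) (by simp)
      · exact h
      · exact absurd ((hi.1 j h).symm.trans hj.2) (by simp)
    refine (Finset.card_biUnion_le_card_mul _ _ U fun i hi => ?_).trans
      ((Nat.mul_le_mul_right _ hone).trans (one_mul U).le)
    rw [Finset.card_map]
    exact hU _

end Composition

/-- Smallest certificates of the copies already fix the address. Not being unambiguous, they can be
much smaller than the designated ones. -/
theorem falseCertLE_cheatSheet (f : BoolFun) :
    FalseCertLE (cheatSheet f) (copies f * certComplexity f.eval + sheetSize f) := by
  classical
  intro x _
  have hS := fun i => exists_certificate_card_le f (copyInput x i)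
  choose S hS hc using hS
  let A : Finset (CheatVar f) := Finset.univ.biUnion fun i =>
    (S i).map ⟨fun v => Sum.inl (i, v), Sum.inl_injective.comp (Prod.mk_right_injective i)⟩
  have hA : A.card ≤ copies f * certComplexity f.eval := by
    refine (Finset.card_biUnion_le_card_mul _ _ (certComplexity f.eval) fun i _ => ?_).trans ?_
    · rw [Finset.card_map]
      exact hS i
    · simp
  refine ⟨A ∪ (cellVars x ∪ positionVars x), ?_, fun y hy => ?_⟩
  · refine (Finset.card_union_le _ _).trans (Nat.add_le_add hA
      ((Finset.card_union_le _ _).trans ?_))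
    exact Nat.add_le_add (card_cellVars x).le (card_positionVars_le x)
  · refine cheatEval_congr (funext fun i => ?_) (fun p => ?_) fun i v hv => ?_
    · exact hc i _ fun v hv => hy _ (Finset.mem_union_left _ (Finset.mem_biUnion.2
        ⟨i, Finset.mem_univ i, Finset.mem_map.2 ⟨v, hv, rfl⟩⟩))
    · exact hy _ (Finset.mem_union_right _ (Finset.mem_union_left _ (mem_cellVars.2 rfl)))
    · exact hy _ (Finset.mem_union_right _ (Finset.mem_union_right _ (mem_positionVars.2 hv)))

theorem card_cheatSheet_var (f : BoolFun) : Fintype.card (cheatSheet f).Var =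
    copies f * Fintype.card f.Var +
      2 ^ copies f * (copies f * (certComplexity f.eval * pointerBits f)) := by
  rw [Fintype.card_congr (Equiv.refl (CheatVar f))]
  simp

theorem card_comp_var (f g : BoolFun) :
    Fintype.card (comp f g).Var = Fintype.card f.Var * Fintype.card g.Var := by
  rw [Fintype.card_congr (Equiv.refl (f.Var × g.Var)), Fintype.card_prod]

/-- The number of cells is exponential in the number of copies, hence polynomial in the number of
variables of `h`. So pointers keep O(log n) bits at every level. -/
theorem card_akkStep_var_le {f : BoolFun} {n l a : ℕ} (hn : n ≤ 2 ^ l) (hl : 1 ≤ l)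
    (hf : Fintype.card f.Var ≤ 2 ^ (a * l)) :
    pointerBits (comp (orFun n) f) ≤ (a + 1) * l ∧
    Fintype.card (comp (andFun n) (cheatSheet (comp (orFun n) f))).Var ≤
      2 ^ (24 * (a + 1) * l) := by
  set h := comp (orFun n) f
  have hN : Fintype.card h.Var ≤ 2 ^ ((a + 1) * l) := by
    rw [card_comp_var, Fintype.card_fin, add_mul, one_mul, add_comm, pow_add]
    exact Nat.mul_le_mul hn hf
  have hL : pointerBits h ≤ (a + 1) * l := Nat.clog_le_of_le_pow hN
  refine ⟨hL, ?_⟩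
  rw [card_comp_var, card_cheatSheet_var, Fintype.card_fin]
  set E := (a + 1) * l
  have hE : l ≤ E := Nat.le_mul_of_pos_left l (Nat.succ_pos a)
  have hc : copies h ≤ 10 * E := Nat.mul_le_mul_left 10 hL
  have hc' : copies h ≤ 2 ^ (10 * E) := hc.trans Nat.lt_two_pow_self.le
  have hL' : pointerBits h ≤ 2 ^ E := hL.trans Nat.lt_two_pow_self.le
  have hC : certComplexity h.eval ≤ 2 ^ E := (certComplexity_le_card _).trans hN
  calc n * (copies h * Fintype.card h.Var +
        2 ^ copies h * (copies h * (certComplexity h.eval * pointerBits h)))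
      ≤ 2 ^ l * (2 ^ (10 * E) * 2 ^ E + 2 ^ (10 * E) * (2 ^ (10 * E) * (2 ^ E * 2 ^ E))) := by
        gcongr
        norm_num
    _ = 2 ^ l * (2 ^ (11 * E) + 2 ^ (22 * E)) := by
        rw [← pow_add, ← pow_add, ← pow_add, ← pow_add]
        ring_nf
    _ ≤ 2 ^ E * (2 ^ (22 * E) + 2 ^ (22 * E)) := by
        gcongr <;> norm_num
    _ = 2 ^ (23 * E + 1) := by ring
    _ ≤ 2 ^ (24 * (a + 1) * l) := by
        rw [mul_assoc]
        exact Nat.pow_le_pow_right two_pos (by omega)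

theorem akkFun_bounds (k : ℕ) : ∃ a p : ℕ, ∀ n, 2 ≤ n →
    Fintype.card (akkFun n k).Var ≤ 2 ^ (a * Nat.clog 2 n) ∧
    (∀ x, ((akkFun n k).cert x).card ≤ a * n ^ (k + 1) * Nat.clog 2 n ^ p) ∧
    FalseCertLE (akkFun n k) (a * n ^ k * Nat.clog 2 n ^ p) ∧
    WithMemory (akkFun n k) (a * n ^ (k + 1) * Nat.clog 2 n ^ p) := by
  induction k with
  | zero =>
    refine ⟨1, 0, fun n hn => ?_⟩
    simp only [one_mul, zero_add, pow_one, pow_zero, mul_one]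
    refine ⟨(Fintype.card_fin n).le.trans (Nat.le_pow_clog one_lt_two n), card_andFun_cert_le n,
      falseCertLE_andFun n, ?_⟩
    have := withMemory_card (andFun n)
    rwa [Fintype.card_fin] at this
  | succ k ih =>
    obtain ⟨a, p, ih⟩ := ih
    -- With `G` bounding the pointer length, every new bound is a sum of terms G²nB or G²B. The
    -- coefficients add up to at most 52, for the memory; G² contributes (a+1)² and two logarithms,
    -- and B contributes the last factor a ≤ a+1.
    refine ⟨60 * (a + 1) ^ 3, p + 2, fun n hn => ?_⟩
    obtain ⟨ihN, ihU, ih0, ihM⟩ := ih n hn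
    have hu := unambiguous_akkFun n k
    have hl : 1 ≤ Nat.clog 2 n := Nat.clog_pos one_lt_two hn
    obtain ⟨hL, hN⟩ := card_akkStep_var_le (Nat.le_pow_clog one_lt_two n) hl ihN
    set l := Nat.clog 2 n
    set f := akkFun n k
    set h := comp (orFun n) f with hh
    set B := a * n ^ (k + 1) * l ^ p with hB
    have huh : Unambiguous h := (unambiguous_orFun n).comp hu
    have hC : certComplexity h.eval ≤ B := by
      refine (certComplexity_comp_orFun_le ihU hu ih0).trans (max_le le_rfl (le_of_eq ?_))
      rw [hB]
      ring
    have hUh : ∀ x, (h.cert x).card ≤ n * B := fun x =>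
      (card_comp_cert_le ihU x).trans (Nat.mul_le_mul_right B (card_orFun_cert_le n _))
    have hMh : WithMemory h (n * B + B) := by
      have := WithMemory.comp (unambiguous_orFun n) hu (withMemory_card _) ihM ihU
      rwa [Fintype.card_fin] at this
    set G := (a + 1) * l with hG
    have hG1 : 1 ≤ G := Nat.mul_pos (Nat.succ_pos a) hl
    have hGG : G ≤ G * G := Nat.le_mul_of_pos_left G hG1
    have hc : copies h ≤ 10 * (G * G) := (Nat.mul_le_mul_left 10 hL).trans (by omega)
    have hQ : sheetSize h ≤ 20 * (G * G) * B := by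
      have hc' : copies h ≤ 10 * G := Nat.mul_le_mul_left 10 hL
      calc sheetSize h ≤ 10 * G * (B * G) + 10 * (G * G) * B := by
            unfold sheetSize
            gcongr
        _ = 20 * (G * G) * B := by ring
    have hnB : B ≤ n * B := Nat.le_mul_of_pos_left B (by omega)
    have hGB : n * B ≤ G * G * (n * B) := Nat.le_mul_of_pos_left _ (by positivity)
    have hGB' : G * G * B ≤ G * G * (n * B) := Nat.mul_le_mul_left _ hnB
    have hcnB : copies h * (n * B) ≤ 10 * (G * G * (n * B)) :=
      (Nat.mul_le_mul_right (n * B) hc).trans (by rw [mul_assoc])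
    have hcB : copies h * B ≤ 10 * (G * G * B) :=
      (Nat.mul_le_mul_right B hc).trans (by rw [mul_assoc])
    have hQ' : sheetSize h ≤ 20 * (G * G * B) := hQ.trans (by rw [mul_assoc])
    have hnQ : n * sheetSize h ≤ 20 * (G * G * (n * B)) :=
      (Nat.mul_le_mul_left n hQ).trans (le_of_eq (by ring))
    have hfin : 60 * (G * G * (n * B)) ≤
        60 * (a + 1) ^ 3 * n ^ (k + 1 + 1) * l ^ (p + 2) := by
      calc 60 * (G * G * (n * B)) = 60 * ((a + 1) ^ 2 * a) * n ^ (k + 1 + 1) * l ^ (p + 2) := by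
            rw [hB, hG]
            ring
        _ ≤ 60 * ((a + 1) ^ 2 * (a + 1)) * n ^ (k + 1 + 1) * l ^ (p + 2) := by
            gcongr
            omega
        _ = _ := by ring
    have hfin₀ : 60 * (G * G * B) ≤ 60 * (a + 1) ^ 3 * n ^ (k + 1) * l ^ (p + 2) := by
      calc 60 * (G * G * B) = 60 * ((a + 1) ^ 2 * a) * n ^ (k + 1) * l ^ (p + 2) := by
            rw [hB, hG]
            ring
        _ ≤ 60 * ((a + 1) ^ 2 * (a + 1)) * n ^ (k + 1) * l ^ (p + 2) := by
            gcongr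
            omega
        _ = _ := by ring
    have h₁ : ∀ x, (cheatSheet h).eval x = true → ((cheatSheet h).cert x).card ≤ sheetSize h :=
      fun x hx => card_cheatSheet_cert_of_true_le hx
    refine ⟨hN.trans (Nat.pow_le_pow_right two_pos (Nat.mul_le_mul_right l ?_)), fun x => ?_,
      fun x hx => ?_, ?_⟩
    · have : (a + 1) * 1 ≤ (a + 1) * (a + 1) ^ 2 := Nat.mul_le_mul_left _ (Nat.pow_pos (by omega))
      calc 24 * (a + 1) ≤ 60 * ((a + 1) * (a + 1) ^ 2) := by omega
        _ = 60 * (a + 1) ^ 3 := by ring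
    · refine (card_comp_andFun_cert_le h₁ (card_cheatSheet_cert_le hUh) x).trans
        (le_trans ?_ hfin)
      omega
    · obtain ⟨S, hS, hSc⟩ := (falseCertLE_cheatSheet h).comp_andFun (n := n) x hx
      refine ⟨S, hS.trans (le_trans ?_ hfin₀), hSc⟩
      have := Nat.mul_le_mul_left (copies h) hC
      omega
    · refine (WithMemory.comp_andFun (n := n) huh.cheatSheet
        (WithMemory.cheatSheet huh hMh hUh) h₁).mono (le_trans ?_ hfin)
      omega

/-! ### The bounds for the formulas -/

/-- `F` has at most `2^W` clauses of width at most `W`, and a Resolution refutation with the same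
bounds. -/
structure SizeWidthLE {V : Type} [DecidableEq V] (F : CNF V) (W : ℕ) : Prop where
  card_le : F.card ≤ 2 ^ W
  width_le : ∀ C ∈ F, C.card ≤ W
  refutation : ∃ π, ResRefutation F π ∧ π.length ≤ 2 ^ W ∧ ∀ C ∈ π, C.card ≤ W

theorem sizeWidthLE_partitionCNF {f : BoolFun} {M t : ℕ} (hM : ∀ x, (f.cert x).card ≤ M)
    (hf : WithMemory f M) (ht : 2 * Fintype.card f.Var + 1 ≤ 2 ^ t) (ht₀ : 1 ≤ t) :
    SizeWidthLE (partitionCNF f) (M * t) := by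
  have hpow : (2 * Fintype.card f.Var + 1) ^ M ≤ 2 ^ (M * t) := by
    rw [mul_comm M t, pow_mul]
    exact Nat.pow_le_pow_left ht M
  have hMt : M ≤ M * t := Nat.le_mul_of_pos_right M ht₀
  obtain ⟨π, hπ, hl, hw⟩ := exists_refutation hM hf
  refine ⟨(card_partitionCNF_le hM).trans hpow, fun C hC => ?_, π, hπ, hl.trans hpow,
    fun C hC => (hw C hC).trans hMt⟩
  obtain ⟨x, rfl⟩ := mem_partitionCNF.1 hC
  exact ((card_certClause f x).trans_le (hM x)).trans hMt

/-- Serves the finitely many `m` with n < 2, where some bound must exist although the asymptotics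
ignore it. -/
theorem exists_sizeWidthLE (f : BoolFun) : ∃ W, SizeWidthLE (partitionCNF f) W :=
  ⟨_, sizeWidthLE_partitionCNF (fun _ => Finset.card_le_univ _) (withMemory_card f)
    Nat.lt_two_pow_self.le (by omega)⟩

theorem sizeWidthLE_comp_xorFun {f : BoolFun} (hf : Unambiguous f) {M t : ℕ}
    (hM : ∀ x, (f.cert x).card ≤ M) (hmem : WithMemory f M) (ht : Fintype.card f.Var ≤ 2 ^ t) :
    SizeWidthLE (partitionCNF (comp f xorFun)) ((M * 2 + 2) * (t + 3)) := by
  have hx : ∀ x, (xorFun.cert x).card ≤ 2 := fun _ => le_rfl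
  refine sizeWidthLE_partitionCNF (fun x => ?_)
    (WithMemory.comp hf unambiguous_xorFun hmem (withMemory_card _) hx) ?_ (by omega)
  · have h1 := card_comp_cert_le hx x
    have h2 := hM fun i => xorFun.eval fun j => x (i, j)
    omega
  · rw [card_comp_var, Fintype.card_fin, pow_add]
    have := Nat.pow_pos (n := t) two_pos
    omega

theorem exists_sizeWidthLE_hittingFormula (k : ℕ) : ∃ (w : ℕ → ℕ) (a p : ℕ),
    (∀ m, SizeWidthLE (hittingFormula k m) (w m)) ∧
      ∀ m, 2 ^ (k + 1) ≤ m → w m ≤ a * m * Nat.clog 2 m ^ p := by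
  obtain ⟨a, p, h⟩ := akkFun_bounds k
  have hex : ∀ m, ∃ W, SizeWidthLE (hittingFormula k m) W ∧
      (2 ^ (k + 1) ≤ m → W ≤ (2 * a + 2) * (a + 3) * m * Nat.clog 2 m ^ (p + 1)) := by
    intro m
    by_cases hm : 2 ^ (k + 1) ≤ m
    · have hn := (Nat.le_nthRoot_iff k.succ_ne_zero).2 hm
      have hnm : Nat.nthRoot (k + 1) m ^ (k + 1) ≤ m :=
        Nat.pow_nthRoot_le_iff.2 (Or.inl k.succ_ne_zero)
      set n := Nat.nthRoot (k + 1) m with hn_def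
      obtain ⟨hN, hU, -, hM⟩ := h n hn
      refine ⟨_, sizeWidthLE_comp_xorFun (unambiguous_akkFun n k) hU hM hN, fun _ => ?_⟩
      have hll : Nat.clog 2 n ≤ Nat.clog 2 m :=
        Nat.clog_mono_right 2 ((Nat.le_self_pow k.succ_ne_zero n).trans hnm)
      have hl : 1 ≤ Nat.clog 2 m := (Nat.clog_pos one_lt_two hn).trans_le hll
      set l := Nat.clog 2 m
      have hone : 1 ≤ m * l ^ p :=
        Nat.mul_pos (lt_of_lt_of_le (by positivity) hm) (Nat.pow_pos hl)
      calc (a * n ^ (k + 1) * Nat.clog 2 n ^ p * 2 + 2) * (a * Nat.clog 2 n + 3)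
          ≤ (a * m * l ^ p * 2 + 2 * (m * l ^ p)) * (a * l + 3 * l) := by
            gcongr <;> omega
        _ = (2 * a + 2) * (a + 3) * m * l ^ (p + 1) := by ring
    · obtain ⟨W, hW⟩ := exists_sizeWidthLE (xorAkk k m)
      exact ⟨W, hW, fun h => absurd h hm⟩
  choose w hw hw' using hex
  exact ⟨w, _, _, hw, hw'⟩

/-- Since 2^{clog m - 1} < m and 1/log 2 < 2, the left side is at most 2 log m + 1, and log m ≥ 1
because m ≥ 3 > e. -/
theorem natClog_two_le_log {m : ℕ} (hm : 3 ≤ m) : (Nat.clog 2 m : ℝ) ≤ 3 * Real.log m := by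
  have h := Nat.pow_pred_clog_lt_self one_lt_two (show 1 < m by omega)
  have hpos : 0 < Nat.clog 2 m := Nat.clog_pos one_lt_two (by omega)
  have hm0 : (0 : ℝ) < m := by positivity
  have h1 : ((Nat.clog 2 m - 1 : ℕ) : ℝ) * Real.log 2 ≤ Real.log m := by
    rw [← Real.log_pow]
    exact Real.log_le_log (by positivity) (by exact_mod_cast h.le)
  rw [Nat.cast_pred hpos] at h1
  have h2 : 1 ≤ Real.log m := by
    rw [Real.le_log_iff_exp_le hm0]
    exact Real.exp_one_lt_d9.le.trans (le_trans (by norm_num) (Nat.cast_le.2 hm))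
  have h3 := Real.log_two_gt_d9
  have h4 : (0 : ℝ) ≤ (Nat.clog 2 m : ℝ) - 1 := by
    rw [sub_nonneg]
    exact_mod_cast hpos
  nlinarith

theorem softO_of_le_clog {w : ℕ → ℕ} {a p m₀ : ℕ}
    (h : ∀ m, m₀ ≤ m → w m ≤ a * m * Nat.clog 2 m ^ p) :
    SoftO (fun m => (w m : ℝ)) fun m => (m : ℝ) := by
  refine ⟨a * 3 ^ p, p, Filter.eventually_atTop.2 ⟨max m₀ 3, fun m hm => ?_⟩⟩
  have h1 : (w m : ℝ) ≤ a * m * (Nat.clog 2 m : ℝ) ^ p := by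
    exact_mod_cast h m (le_trans (le_max_left _ _) hm)
  have h2 := natClog_two_le_log (le_trans (le_max_right _ _) hm)
  calc (w m : ℝ) ≤ a * m * (Nat.clog 2 m : ℝ) ^ p := h1
    _ ≤ a * m * (3 * Real.log m) ^ p := by gcongr
    _ = a * 3 ^ p * (m * Real.log m ^ p) := by rw [mul_pow]; ring

theorem softOmega_depth {ε : ℝ} {k : ℕ} (hk : 1 / ((k : ℝ) + 1) ≤ ε) :
    SoftOmega (fun m => ((akkFun (Nat.nthRoot (k + 1) m) k).depth : ℝ))
      fun m => (m : ℝ) ^ (2 - ε) := by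
  -- No logarithm is lost. The factor 2^{2k+1} comes from m < (n+1)^{k+1} ≤ (2n)^{k+1}, the factor
  -- 2^k from the cheat sheets; the exponent is (2k+1)/(k+1) = 2 - 1/(k+1) ≥ 2 - ε.
  refine ⟨1 / (2 ^ (2 * k + 1) * 2 ^ k), 0, by positivity,
    Filter.eventually_atTop.2 ⟨2 ^ (k + 1), fun m hm => ?_⟩⟩
  have hn := (Nat.le_nthRoot_iff k.succ_ne_zero).2 hm
  have hlt := Nat.lt_pow_nthRoot_add_one k.succ_ne_zero m
  set n := Nat.nthRoot (k + 1) m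
  have hd : (n : ℝ) ^ (2 * k + 1) ≤ 2 ^ k * ((akkFun n k).depth : ℝ) := by
    exact_mod_cast pow_le_depth_akkFun hn k
  have hm1 : (1 : ℝ) ≤ m := by
    exact_mod_cast (Nat.one_le_two_pow).trans hm
  have hm2 : (m : ℝ) ≤ (2 * n : ℝ) ^ (k + 1) := by
    exact_mod_cast hlt.le.trans (Nat.pow_le_pow_left (by omega) _)
  have hk0 : (0 : ℝ) < (k : ℝ) + 1 := by positivity
  have hroot : (m : ℝ) ^ (1 / ((k : ℝ) + 1)) ≤ 2 * n := by
    calc (m : ℝ) ^ (1 / ((k : ℝ) + 1)) ≤ ((2 * n : ℝ) ^ (k + 1)) ^ (1 / ((k : ℝ) + 1)) := by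
          gcongr
      _ = 2 * n := by
          rw [one_div, ← Nat.cast_succ]
          exact Real.pow_rpow_inv_natCast (by positivity) k.succ_ne_zero
  have hexp : (m : ℝ) ^ (2 - ε) ≤ (2 * n : ℝ) ^ (2 * k + 1) := by
    calc (m : ℝ) ^ (2 - ε) ≤ (m : ℝ) ^ (1 / ((k : ℝ) + 1) * (2 * k + 1 : ℕ)) := by
          refine Real.rpow_le_rpow_of_exponent_le hm1 ?_
          have : 1 / ((k : ℝ) + 1) * (2 * k + 1 : ℕ) = 2 - 1 / ((k : ℝ) + 1) := by
            push_cast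
            field_simp
            ring
          linarith
      _ = ((m : ℝ) ^ (1 / ((k : ℝ) + 1))) ^ (2 * k + 1) :=
          Real.rpow_mul_natCast (by positivity) _ _
      _ ≤ (2 * n : ℝ) ^ (2 * k + 1) := by gcongr
  rw [pow_zero, div_one, one_div, inv_mul_le_iff₀ (by positivity)]
  calc (m : ℝ) ^ (2 - ε) ≤ 2 ^ (2 * k + 1) * (n : ℝ) ^ (2 * k + 1) := by rwa [mul_pow] at hexp
    _ ≤ 2 ^ (2 * k + 1) * (2 ^ k * ((akkFun n k).depth : ℝ)) := by gcongr
    _ = _ := by ring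

end HittingRes

theorem mainTheorem7 (ε : ℝ) (hε : 0 < ε) (k : ℕ) (hk : 1 / ((k : ℝ) + 1) ≤ ε) :
    -- `G_m` is an unsatisfiable hitting formula
    (∀ m : ℕ, HittingRes.IsHitting (HittingRes.hittingFormula k m) ∧
      HittingRes.Unsat (HittingRes.hittingFormula k m)) ∧
    -- `G_m` has `2^{Õ(m)}` clauses, of width `Õ(m)`
    (∃ w : ℕ → ℝ, HittingRes.SoftO w (fun m => (m : ℝ)) ∧ ∀ m : ℕ,
      ((HittingRes.hittingFormula k m).card : ℝ) ≤ (2 : ℝ) ^ w m ∧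
      ∀ C ∈ HittingRes.hittingFormula k m, (C.card : ℝ) ≤ w m) ∧
    -- `G_m` requires tree-like Resolution size `2^{Ω̃(m^{2-ε})}`
    (∃ h : ℕ → ℝ, HittingRes.SoftOmega h (fun m => (m : ℝ) ^ (2 - ε)) ∧ ∀ m s : ℕ,
      HittingRes.TreeResDerivation (HittingRes.hittingFormula k m) ∅ s →
        (2 : ℝ) ^ h m ≤ (s : ℝ)) ∧
    -- `G_m` has a Resolution refutation of width `Õ(m)` and size `2^{Õ(m)}`
    (∃ w : ℕ → ℝ, HittingRes.SoftO w (fun m => (m : ℝ)) ∧ ∀ m : ℕ,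
      ∃ π : List (HittingRes.Clause (HittingRes.xorAkk k m).Var),
        HittingRes.ResRefutation (HittingRes.hittingFormula k m) π ∧
        (π.length : ℝ) ≤ (2 : ℝ) ^ w m ∧
        ∀ C ∈ π, (C.card : ℝ) ≤ w m) := by
  obtain ⟨w, a, p, hw, hwle⟩ := HittingRes.exists_sizeWidthLE_hittingFormula k
  have hO := HittingRes.softO_of_le_clog hwle
  have hcast : ∀ {m c : ℕ}, c ≤ 2 ^ w m → (c : ℝ) ≤ (2 : ℝ) ^ (w m : ℝ) := fun h => by
    rw [Real.rpow_natCast]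
    exact_mod_cast h
  refine ⟨fun m => ⟨(HittingRes.unambiguous_xorAkk k m).isHitting,
    HittingRes.unsat_partitionCNF _⟩, ⟨_, hO, fun m => ⟨hcast (hw m).card_le, fun C hC =>
    Nat.cast_le.2 ((hw m).width_le C hC)⟩⟩, ⟨_, HittingRes.softOmega_depth hk, fun m s hs => ?_⟩,
    ⟨_, hO, fun m => ?_⟩⟩
  · rw [Real.rpow_natCast]
    exact_mod_cast (HittingRes.unambiguous_akkFun _ k).two_pow_depth_le hs
  · obtain ⟨π, hπ, hl, hc⟩ := (hw m).refutation
    exact ⟨π, hπ, hcast hl, fun C hC => Nat.cast_le.2 (hc C hC)⟩
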